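/- Let $q\ge 3$ be an integer and $0<p<1$. Let $\mathcal T_q$ be the homogeneous tree of degree $q$, identified with the free product of $q$ copies of $\mathbb Z/2$ with generators $a_1,\dots,a_q$ of order two; its vertices are the finite words over $\{a_1,\dots,a_q\}$ without two equal consecutive letters, and its root $o$ is the empty word. Let $\mathcal L_q=(\mathbb Z/2)\wr\mathcal T_q$ be the group of all pairs $(\eta,x)$, where $x\in\mathcal T_q$ and $\eta:\mathcal T_q\to\mathbb Z/2$ has finite support, with product $(\eta_1,x)(\eta_2,y)=(\eta_1+x\eta_2,\,xy)$, where $(x\eta)(w)=\eta(x^{-1}w)$. For $z\in\mathcal L_q$ let $\ell(z)$ be the distance of $z$ to the identity $(\mathbf 0,o)$ in the Cayley graph of $\mathcal L_q$ with generators $(\mathbf 1_o,o),(\mathbf 0,a_1),\dots,(\mathbf 0,a_q)$. Let $\mathbf i_1,\mathbf i_2,\dots$ be i.i.d. $\mathcal L_q$-valued random variables which equal $(\mathbf 1_o,o)$ with probability $p$ and each $(\mathbf 0,a_i)$ with probability $(1-p)/q$, and let $Z_n=(\eta_n,X_n)=\mathbf i_1\cdots \mathbf i_n$, $Z_0=(\mathbf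 0,o)$. Almost surely, $X_n$ converges in the end topology to a random end $X_\infty$ of $\mathcal T_q$ (an infinite word without two equal consecutive letters), $\eta_n$ converges pointwise to a random configuration $\eta_\infty:\mathcal T_q\to\mathbb Z/2$, and $\ell(Z_n)/n$ converges to a constant $\ell$, the rate of escape. For any letter $a\in\{a_1,\dots,a_q\}$ let $C_a\subset\mathcal T_q$ be the set of all words with first letter $a$, and put $$\nu_1=\mathbb P\bigl[a\text{ is not the first letter of }X_\infty,\ \eta_\infty|_{C_a}\not\equiv 0\bigr],\qquad \nu_2=\mathbb P\bigl[a\text{ is the first letter of }X_\infty,\ \eta_\infty|_{\mathcal T_q\setminus C_a}\equiv 0\bigr].$$ Then $$\ell=\frac{(1-p)(q-2)}{q}\Bigl(1+2q\,\nu_1+\frac{pq}{pq+q-2}\Bigr)=\frac{(1-p)(q-2)}{q}\Bigl(\frac{q+1}{q-1}-\frac{2q}{q-1}\,\nu_2+\frac{pq}{pq+q-2}\Bigr).$$ -/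

import Mathlib

open MeasureTheory ProbabilityTheory Filter Topology

noncomputable section

namespace LampTree

/-- The vertex set of the homogeneous tree of degree `q`, identified with the free product of `q`
copies of `ℤ/2`. -/
abbrev Tree (q : ℕ) : Type :=
  Monoid.CoprodI (fun _ : Fin q => Multiplicative (ZMod 2))

/-- The generator `a_i` of order two of the free product. -/
def gen {q : ℕ} (i : Fin q) : Tree q :=
  Monoid.CoprodI.of (i := i) (Multiplicative.ofAdd (1 : ZMod 2))

/-- The reduced word of `x`: the list of indices of its letters. (Each factor `ℤ/2` has exactly one
non-trivial element, so the index determines the letter.) -/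
def letters {q : ℕ} (x : Tree q) : List (Fin q) :=
  (Monoid.CoprodI.Word.equiv x).toList.map Sigma.fst

/-- The cone `C_w`: all vertices whose reduced word has the reduced word of `w` as a prefix. -/
def cone {q : ℕ} (w : Tree q) : Set (Tree q) :=
  {x | letters w <+: letters x}

/-- The ends of the tree: infinite words without two equal consecutive letters. -/
def TreeEnd (q : ℕ) : Type :=
  {ξ : ℕ → Fin q // ∀ n, ξ n ≠ ξ (n + 1)}

/-- The `σ`-algebra on the ends is generated by the coordinates. -/
instance (q : ℕ) : MeasurableSpace (TreeEnd q) :=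
  inferInstanceAs (MeasurableSpace {ξ : ℕ → Fin q // ∀ n, ξ n ≠ ξ (n + 1)})

/-- The boundary of the cone `C_w`: the infinite words that have the word of `w` as a prefix. -/
def coneBoundary {q : ℕ} (w : Tree q) : Set (TreeEnd q) :=
  {ξ | (List.range (letters w).length).map ξ.1 = letters w}

/-- The tree together with its ends. -/
inductive TreeHat (q : ℕ) : Type
  | vertex (x : Tree q) : TreeHat q
  | boundary (ξ : TreeEnd q) : TreeHat q

/-- The completed cone: `C_w` together with its boundary. -/
def coneHat {q : ℕ} (w : Tree q) : Set (TreeHat q) :=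
  TreeHat.vertex '' cone w ∪ TreeHat.boundary '' coneBoundary w

/-- The end topology: vertices are isolated, and the completed cones along an end form a
neighbourhood basis of this end. -/
instance (q : ℕ) : TopologicalSpace (TreeHat q) :=
  TopologicalSpace.generateFrom
    (Set.range (fun x : Tree q => ({TreeHat.vertex x} : Set (TreeHat q))) ∪
      Set.range (fun w : Tree q => coneHat w))

/-- Elements of the lamplighter group `(ℤ/2) ≀ Tree q`: a finitely supported lamp configuration
and a position of the lamplighter. -/
@[ext]
structure Lamplighter (q : ℕ) : Type where
  lamp : Tree q →₀ ZMod 2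
  pos : Tree q

/-- The translate `xη`, with `(xη)(w) = η(x⁻¹w)`. -/
def shift {q : ℕ} (x : Tree q) (η : Tree q →₀ ZMod 2) : Tree q →₀ ZMod 2 :=
  Finsupp.equivMapDomain (Equiv.mulLeft x) η

theorem shift_apply {q : ℕ} (x : Tree q) (η : Tree q →₀ ZMod 2) (w : Tree q) :
    shift x η w = η (x⁻¹ * w) := rfl

instance (q : ℕ) : Mul (Lamplighter q) := ⟨fun g h => ⟨g.lamp + shift g.pos h.lamp, g.pos * h.pos⟩⟩

instance (q : ℕ) : One (Lamplighter q) := ⟨⟨0, 1⟩⟩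

instance (q : ℕ) : Inv (Lamplighter q) := ⟨fun g => ⟨-shift g.pos⁻¹ g.lamp, g.pos⁻¹⟩⟩

theorem lamp_mul {q : ℕ} (g h : Lamplighter q) : (g * h).lamp = g.lamp + shift g.pos h.lamp := rfl

theorem pos_mul {q : ℕ} (g h : Lamplighter q) : (g * h).pos = g.pos * h.pos := rfl

theorem lamp_one {q : ℕ} : (1 : Lamplighter q).lamp = 0 := rfl

theorem pos_one {q : ℕ} : (1 : Lamplighter q).pos = 1 := rfl

theorem lamp_inv {q : ℕ} (g : Lamplighter q) : (g⁻¹).lamp = -shift g.pos⁻¹ g.lamp := rfl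

theorem pos_inv {q : ℕ} (g : Lamplighter q) : (g⁻¹).pos = g.pos⁻¹ := rfl

instance (q : ℕ) : Group (Lamplighter q) :=
  Group.ofLeftAxioms
    (fun a b c => by
      ext w
      · simp [lamp_mul, pos_mul, shift_apply, mul_assoc, add_assoc]
      · simp [pos_mul, mul_assoc])
    (fun a => by
      ext w
      · simp [lamp_mul, lamp_one, pos_one, shift_apply]
      · simp [pos_mul, pos_one])
    (fun a => by
      ext w
      · simp [lamp_mul, lamp_one, lamp_inv, pos_inv]
      · simp [pos_mul, pos_one, pos_inv])

/-- The discrete `σ`-algebra on the (countable) lamplighter group. -/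
instance (q : ℕ) : MeasurableSpace (Lamplighter q) := ⊤

/-- The generator that switches the lamp at the position of the lamplighter. -/
def switchGen (q : ℕ) : Lamplighter q := ⟨Finsupp.single 1 1, 1⟩

/-- The generator that moves the lamplighter along the edge labelled `i`. -/
def moveGen {q : ℕ} (i : Fin q) : Lamplighter q := ⟨0, gen i⟩

/-- The generating set of the lamplighter group. -/
def generators (q : ℕ) : Set (Lamplighter q) := insert (switchGen q) (Set.range moveGen)

/-- The length of `z`: the distance of `z` to the identity in the Cayley graph. -/
def length {q : ℕ} (z : Lamplighter q) : ℕ :=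
  (SimpleGraph.mulCayley (generators q)).dist z 1

open Classical in
/-- The step distribution: switch with probability `p`, otherwise move to a uniform neighbour. -/
def stepProb (q : ℕ) (p : ℝ) (w : Lamplighter q) : ℝ :=
  if w = switchGen q then p else if ∃ i, w = moveGen i then (1 - p) / q else 0

/-- The walk `Z_n` started at the identity; its `n`-th step, `n ≥ 1`, is the increment
`inc (n - 1)`. -/
def walk {q : ℕ} {Ω : Type*} (inc : ℕ → Ω → Lamplighter q) : ℕ → Ω → Lamplighter q
  | 0, _ => 1
  | n + 1, ω => walk inc n ω * inc n ω

/-- `X` is almost surely the limit in the end topology of the lamplighter's positions. -/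
def IsLimitEnd {q : ℕ} {Ω : Type*} [MeasurableSpace Ω] (P : Measure Ω)
    (inc : ℕ → Ω → Lamplighter q) (X : Ω → TreeEnd q) : Prop :=
  ∀ᵐ ω ∂P, Tendsto (fun n => TreeHat.vertex (walk inc n ω).pos) atTop (𝓝 (TreeHat.boundary (X ω)))

/-- `η` is almost surely the pointwise limit of the lamp configurations. -/
def IsLimitLamps {q : ℕ} {Ω : Type*} [MeasurableSpace Ω] (P : Measure Ω)
    (inc : ℕ → Ω → Lamplighter q) (η : Ω → Tree q → ZMod 2) : Prop :=
  ∀ᵐ ω ∂P, ∀ w, Tendsto (fun n => (walk inc n ω).lamp w) atTop (𝓝 (η ω w))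

/-- The probability that `a` is not the first letter of the limiting end and some lamp in the cone
`C_a` is finally on. -/
def nu1 {q : ℕ} {Ω : Type*} [MeasurableSpace Ω] (P : Measure Ω)
    (X : Ω → TreeEnd q) (η : Ω → Tree q → ZMod 2) (a : Fin q) : ℝ :=
  P.real {ω | (X ω).1 0 ≠ a ∧ ¬ ∀ w ∈ cone (gen a), η ω w = 0}

/-- The probability that `a` is the first letter of the limiting end and all lamps outside the cone
`C_a` are finally off. -/
def nu2 {q : ℕ} {Ω : Type*} [MeasurableSpace Ω] (P : Measure Ω)
    (X : Ω → TreeEnd q) (η : Ω → Tree q → ZMod 2) (a : Fin q) : ℝ :=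
  P.real {ω | (X ω).1 0 = a ∧ ∀ w ∈ (cone (gen a))ᶜ, η ω w = 0}

end LampTree

end

noncomputable section

namespace LampTree

variable {q : ℕ}

/-! The walk is read from its front: by `traj_succ'` the position at time `n + 1` is `s * Z`, where
`s` is the first step and `Z` is a walk of `n` steps driven by the remaining steps, independent of
`s`. The mean increment of the length is therefore the average over generators `s` of the expected
value of `length (s * Z) - length Z`, and left multiplication by a generator changes the length in a
way that depends only on coarse features of `Z`.

The length is that of a tour in the tree (`length_eq_tourLength`): one unit per lit lamp, two per
edge of the subtree spanned by the root, the lit lamps and the final position, minus one per edge on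
the geodesic to the final position. Switching in front only toggles the lamp at the root. Moving
along `a` in front only alters the use of the edge between the root and `a`: the tour grows exactly
when the lamplighter is in `C_a` with a lit lamp outside, or outside `C_a` with no lit lamp inside
(`tourLength_move`).

The walk is transient, so these features stabilise almost surely. Dominated convergence and Cesàro
averaging give `meanLength μ n / n → speed μ`, the expected limiting change (`tendsto_meanLength`).
Almost sure convergence to the same constant is a subadditive ergodic theorem proved by hand: the
law of large numbers for blocks bounds from above (`ae_eventually_length_lt`), and a zero-one law
with a covering argument bounds from below (`seqLaw_slowSet`).

It remains to compute. A letter change in front fails to lengthen the tour with limiting probability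
`ν₁ + ν₂` (`real_moveUpLim`). By symmetry the walk ends in `C_a` with probability `1/q`. Since `C_a`
is entered only through `a`, and left multiplication by `a` exchanges `C_a` with its complement, the
strong Markov property at the first visit of `a` gives hitting probability `F = 1/(q-1)`, then `ν₁ =
F (1/q - ν₂)` (`onInside_prob`), and an equation `r = p(1-r) + (1-p) F r` for the probability `r`
that the root lamp is finally on. Hence `speed = p(1-2r) + (1-p)(1-2ν₁-2ν₂)`, which is either
formula after eliminating `ν₂` or `ν₁` (`speed_eq`). -/

/-! ### Reduced words, cones and multiplication by generators -/

theorem zmod_two_ne_one {m : Multiplicative (ZMod 2)} (h : m ≠ 1) :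
    m = Multiplicative.ofAdd (1 : ZMod 2) := by
  revert m; decide

theorem gen_mul_self (i : Fin q) : gen i * gen i = 1 := by
  unfold gen
  rw [← map_mul, show Multiplicative.ofAdd (1 : ZMod 2) * Multiplicative.ofAdd 1 = 1 by decide,
    map_one]

theorem gen_inv (i : Fin q) : (gen i)⁻¹ = gen i := by
  rw [inv_eq_iff_mul_eq_one, gen_mul_self]

theorem gen_mul_cancel (i : Fin q) (x : Tree q) : gen i * (gen i * x) = x := by
  rw [← mul_assoc, gen_mul_self, one_mul]

/-- The reduced word of a vertex. -/
abbrev wordOf (x : Tree q) : Monoid.CoprodI.Word (fun _ : Fin q => Multiplicative (ZMod 2)) :=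
  Monoid.CoprodI.Word.equiv x

theorem wordOf_prod (w : Monoid.CoprodI.Word (fun _ : Fin q => Multiplicative (ZMod 2))) :
    wordOf w.prod = w := Monoid.CoprodI.Word.equiv.apply_symm_apply w

theorem prod_wordOf (x : Tree q) : (wordOf x).prod = x :=
  Monoid.CoprodI.Word.equiv.symm_apply_apply x

theorem letters_one : letters (1 : Tree q) = [] := by
  have : wordOf (1 : Tree q) = Monoid.CoprodI.Word.empty := by
    rw [← Monoid.CoprodI.Word.prod_empty, wordOf_prod]
  simp [letters, this, Monoid.CoprodI.Word.empty]

theorem fstIdx_eq_head? (x : Tree q) :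
    (wordOf x).fstIdx = (letters x).head? := by
  simp [Monoid.CoprodI.Word.fstIdx, letters]

theorem letters_gen_mul_of_ne {i : Fin q} {x : Tree q} (h : (letters x).head? ≠ some i) :
    letters (gen i * x) = i :: letters x := by
  have h1 : (Multiplicative.ofAdd (1 : ZMod 2)) ≠ 1 := by decide
  rw [← fstIdx_eq_head?] at h
  have : wordOf (gen i * x) =
      Monoid.CoprodI.Word.cons (M := fun _ : Fin q => Multiplicative (ZMod 2))
        (Multiplicative.ofAdd (1 : ZMod 2)) (wordOf x) h h1 := by
    rw [← wordOf_prod (Monoid.CoprodI.Word.cons _ _ h h1), Monoid.CoprodI.Word.prod_cons,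
      prod_wordOf]
    rfl
  simp [letters, this, Monoid.CoprodI.Word.cons]

/-- Only reduced products occur in the inductive step, so `letters_gen_mul_of_ne` always applies
there. -/
theorem tree_induction {motive : Tree q → Prop} (one : motive 1)
    (gen_mul : ∀ (i : Fin q) (y : Tree q), (letters y).head? ≠ some i → motive y →
      motive (gen i * y)) (x : Tree q) : motive x := by
  suffices h : ∀ w : Monoid.CoprodI.Word (fun _ : Fin q => Multiplicative (ZMod 2)),
      motive w.prod by
    have := h (wordOf x)
    rwa [prod_wordOf] at this
  intro w
  induction w using Monoid.CoprodI.Word.consRecOn with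
  | empty => simpa using one
  | cons i m w h1 h2 ih =>
    rw [Monoid.CoprodI.Word.prod_cons, zmod_two_ne_one h2]
    refine gen_mul i _ ?_ ih
    rwa [← fstIdx_eq_head?, wordOf_prod]

theorem letters_injective : Function.Injective (letters : Tree q → List (Fin q)) := by
  intro x
  induction x using tree_induction with
  | one =>
    intro y
    induction y using tree_induction with
    | one => simp
    | gen_mul i y hy _ => simp [letters_one, letters_gen_mul_of_ne hy]
  | gen_mul i x hx ih =>
    intro y
    induction y using tree_induction with
    | one => simp [letters_one, letters_gen_mul_of_ne hx]
    | gen_mul j y hy _ =>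
      rw [letters_gen_mul_of_ne hx, letters_gen_mul_of_ne hy]
      intro h
      injection h with h1 h2
      rw [h1, ih h2]

instance : Countable (Tree q) := letters_injective.countable

theorem letters_eq_nil {x : Tree q} : letters x = [] ↔ x = 1 := by
  rw [← letters_one, letters_injective.eq_iff]

theorem exists_eq_gen_mul {i : Fin q} {l : List (Fin q)} {x : Tree q} (h : letters x = i :: l) :
    ∃ y, x = gen i * y ∧ letters y = l ∧ l.head? ≠ some i := by
  induction x using tree_induction with
  | one => simp [letters_one] at h
  | gen_mul j y hy _ =>
    rw [letters_gen_mul_of_ne hy] at h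
    injection h with h1 h2
    subst h1 h2
    exact ⟨y, rfl, rfl, hy⟩

theorem letters_gen_mul_of_eq {i : Fin q} {l : List (Fin q)} {x : Tree q}
    (h : letters x = i :: l) : letters (gen i * x) = l := by
  obtain ⟨y, rfl, h, _⟩ := exists_eq_gen_mul h
  rw [gen_mul_cancel, h]

theorem letters_gen (i : Fin q) : letters (gen i) = [i] := by
  simpa [letters_one] using letters_gen_mul_of_ne (i := i) (x := 1) (by simp [letters_one])

theorem letters_chain (x : Tree q) : (letters x).IsChain (· ≠ ·) := by
  induction x using tree_induction with
  | one => simp [letters_one]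
  | gen_mul i y hy ih =>
    rw [letters_gen_mul_of_ne hy]
    cases h : letters y with
    | nil => simp
    | cons j l => 
      rw [h] at ih hy
      refine List.IsChain.cons_cons ?_ ih
      rintro rfl
      simp at hy

/-- Multiplying by a generator on the right appends or deletes one letter. -/
theorem letters_mul_gen (x : Tree q) (i : Fin q) :
    letters (x * gen i) = letters x ++ [i] ∨ letters x = letters (x * gen i) ++ [i] := by
  induction x using tree_induction with
  | one => simp [letters_one, letters_gen]
  | gen_mul j y hy ih =>
    rw [mul_assoc, letters_gen_mul_of_ne hy]
    rcases ih with h | h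
    · by_cases hj : (letters (y * gen i)).head? = some j
      · right
        cases hl : letters y with
        | nil =>
          rw [h, hl] at hj
          simp only [List.nil_append, List.head?_cons, Option.some.injEq] at hj
          rw [letters_gen_mul_of_eq (l := []) (by rw [h, hl, hj]; rfl), hj]
          rfl
        | cons k l => rw [h] at hj; rw [hl] at hj hy; exact absurd hj hy
      · left
        rw [letters_gen_mul_of_ne hj, h]
        rfl
    · right
      rw [letters_gen_mul_of_ne, ← List.cons_append.symm, ← h]
      · cases hl : letters (y * gen i) with
        | nil => simp
        | cons k l => rw [h, hl] at hy; exact hy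

theorem mem_cone_gen {a : Fin q} {x : Tree q} : x ∈ cone (gen a) ↔ (letters x).head? = some a := by
  simp only [cone, Set.mem_ofPred_eq, letters_gen]
  cases letters x with
  | nil => simp
  | cons b l => simp [eq_comm]

theorem one_notMem_cone (a : Fin q) : (1 : Tree q) ∉ cone (gen a) := by
  simp [mem_cone_gen, letters_one]

theorem gen_mul_mem_cone {a : Fin q} {x : Tree q} :
    gen a * x ∈ cone (gen a) ↔ x ∉ cone (gen a) := by
  rw [mem_cone_gen, mem_cone_gen]
  constructor
  · intro h h'
    obtain ⟨l, hl⟩ : ∃ l, letters x = a :: l := by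
      cases hx : letters x with
      | nil => simp [hx] at h'
      | cons b l => simp [hx] at h'; exact ⟨l, by rw [h']⟩
    obtain ⟨y, rfl, h1, h2⟩ := exists_eq_gen_mul hl
    rw [gen_mul_cancel, h1] at h
    exact h2 h
  · intro h
    rw [letters_gen_mul_of_ne h]; rfl

/-- The cone `C_a` can only be entered through the vertex `a`. -/
theorem eq_gen_of_enter {a : Fin q} {x : Tree q} {i : Fin q} (hx : x ∉ cone (gen a))
    (h : x * gen i ∈ cone (gen a)) : x * gen i = gen a := by
  rw [mem_cone_gen] at hx h
  apply letters_injective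
  rw [letters_gen]
  rcases letters_mul_gen x i with h1 | h1
  · cases hl : letters x with
    | nil => rw [h1, hl] at h ⊢; simp at h; simp [h]
    | cons b l => rw [h1, hl] at h; rw [hl] at hx; simp at h hx; exact absurd h hx
  · rw [h1] at hx
    cases hl : letters (x * gen i) with
    | nil => rw [hl] at h; simp at h
    | cons b l => rw [hl] at h hx; simp at h hx; exact absurd h hx

theorem length_gen_mul (x : Tree q) (i : Fin q) :
    (letters (gen i * x)).length = (letters x).length + 1 ∧ (letters x).head? ≠ some i ∨
      (letters x).length = (letters (gen i * x)).length + 1 ∧ (letters x).head? = some i := by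
  by_cases h : (letters x).head? = some i
  · right
    cases hl : letters x with
    | nil => simp [hl] at h
    | cons b l =>
      simp [hl] at h; subst h
      simp [letters_gen_mul_of_eq hl]
  · left; simp [letters_gen_mul_of_ne h, h]

/-- Neighbouring vertices of length at least `k` have the same prefix of length `k`. -/
theorem take_letters_mul_gen {x : Tree q} {i : Fin q} {k : ℕ} (h1 : k ≤ (letters x).length)
    (h2 : k ≤ (letters (x * gen i)).length) :
    (letters (x * gen i)).take k = (letters x).take k := by
  rcases letters_mul_gen x i with h | h
  · rw [h, List.take_append_of_le_length h1]
  · rw [h, List.take_append_of_le_length h2]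

/-! ### The length formula -/

/-- The nontrivial vertices on the geodesics from the root to the points of `A`. -/
def hull (A : Set (Tree q)) : Set (Tree q) := {w | w ≠ 1 ∧ (A ∩ cone w).Nonempty}

theorem hull_mono {A B : Set (Tree q)} (h : A ⊆ B) : hull A ⊆ hull B :=
  fun _ hw => ⟨hw.1, hw.2.mono (Set.inter_subset_inter_left _ h)⟩

theorem hull_finite {A : Set (Tree q)} (hA : A.Finite) : (hull A).Finite := by
  have : hull A ⊆ ⋃ v ∈ A, letters ⁻¹' {l | l ∈ (letters v).inits} := by
    rintro w ⟨-, v, hv, hw⟩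
    simp only [Set.mem_iUnion]
    exact ⟨v, hv, by simpa [cone] using hw⟩
  refine (hA.biUnion fun v _ => ?_).subset this
  exact (List.finite_toSet _).preimage letters_injective.injOn

/-- A nontrivial vertex `w` stands for the edge to its parent. Left multiplication by `gen a` is a
tree automorphism swapping `1` and `gen a`, so it respects the parent relation on every edge except
the one joining these two. -/
theorem mem_cone_gen_mul {a : Fin q} {w x : Tree q} (h1 : w ≠ 1) (h2 : w ≠ gen a) :
    gen a * x ∈ cone (gen a * w) ↔ x ∈ cone w := by
  have key : ∀ {w x : Tree q}, w ≠ 1 → w ≠ gen a → x ∈ cone w → gen a * x ∈ cone (gen a * w) := by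
    intro w x h1 h2 h
    obtain ⟨t, ht⟩ := h
    cases hw : letters w with
    | nil => exact absurd (letters_eq_nil.1 hw) h1
    | cons b l =>
      rw [hw] at ht
      by_cases hb : b = a
      · subst hb
        refine ⟨t, ?_⟩
        rw [letters_gen_mul_of_eq hw, letters_gen_mul_of_eq ht.symm]
        rfl
      · refine ⟨t, ?_⟩
        rw [letters_gen_mul_of_ne (by simp [hw, hb]), letters_gen_mul_of_ne (by simp [← ht, hb]),
          hw, ← ht]
        rfl
  refine ⟨fun h => ?_, key h1 h2⟩
  -- The converse is the same implication applied to the translates, since `gen a` is an involution.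
  have := key (w := gen a * w) (x := gen a * x) ?_ ?_ h
  · simpa [gen_mul_cancel] using this
  · intro h; apply h2; rw [← gen_mul_cancel a w, h, mul_one]
  · intro h; apply h1; simpa using h

-- By `mem_cone_gen_mul` the two hulls correspond except at the edge of `gen a`. That edge belongs
-- to the hull of `A` iff `A` meets the cone, and to the hull of the translate iff `A` leaves the
-- cone.
open Classical in
theorem ncard_hull_gen_mul (a : Fin q) {A : Set (Tree q)} (hA : A.Finite) :
    (hull ((gen a * ·) '' A)).ncard + (if (A ∩ cone (gen a)).Nonempty then 1 else 0) =
      (hull A).ncard + (if A ⊆ cone (gen a) then 0 else 1) := by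
  have e1 : hull ((gen a * ·) '' A) \ {gen a} = (gen a * ·) '' (hull A \ {gen a}) := by
    ext w
    have hw : w = gen a * (gen a * w) := (gen_mul_cancel a w).symm
    have h0 : w ≠ 1 ↔ gen a * w ≠ gen a := by simp
    have h1 : w ≠ gen a ↔ gen a * w ≠ 1 := by
      rw [ne_eq, ne_eq, mul_eq_one_iff_eq_inv', gen_inv]
    have h2 : w ∈ (gen a * ·) '' (hull A \ {gen a}) ↔ gen a * w ∈ hull A \ {gen a} := by
      constructor
      · rintro ⟨v, hv, rfl⟩; simpa [gen_mul_cancel] using hv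
      · intro h; exact ⟨_, h, gen_mul_cancel a w⟩
    rw [h2]
    simp only [hull, Set.mem_sdiff, Set.mem_ofPred_eq, Set.mem_singleton_iff]
    constructor
    · rintro ⟨⟨h3, -, ⟨v, hv, rfl⟩, h4⟩, h5⟩
      refine ⟨⟨h1.1 h5, v, hv, ?_⟩, h0.1 h3⟩
      have := (mem_cone_gen_mul (a := a) h3 h5).2 h4
      simpa [gen_mul_cancel] using this
    · rintro ⟨⟨h3, v, hv, h4⟩, h5⟩
      refine ⟨⟨h0.2 h5, gen a * v, ⟨v, hv, rfl⟩, ?_⟩, h1.2 h3⟩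
      have := (mem_cone_gen_mul (a := a) h3 h5).2 h4
      simpa [gen_mul_cancel] using this
  have hg : gen a ≠ (1 : Tree q) := by
    intro h; simpa [letters_gen, letters_one] using congrArg letters h
  have e2 : ∀ B : Set (Tree q), B.Finite → (hull B).ncard =
      (hull B \ {gen a}).ncard + (if (B ∩ cone (gen a)).Nonempty then 1 else 0) := by
    intro B hB
    split_ifs with h
    · exact (Set.ncard_sdiff_singleton_add_one (show gen a ∈ hull B from ⟨hg, h⟩) (hull_finite hB)).symm
    · rw [Set.sdiff_singleton_eq_self fun h' => h h'.2, add_zero]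
  have e3 : (((gen a * ·) '' A) ∩ cone (gen a)).Nonempty ↔ ¬ A ⊆ cone (gen a) := by
    rw [Set.not_subset]
    constructor
    · rintro ⟨_, ⟨v, hv, rfl⟩, h⟩
      exact ⟨v, hv, gen_mul_mem_cone.1 h⟩
    · rintro ⟨v, hv, h⟩
      exact ⟨_, ⟨v, hv, rfl⟩, gen_mul_mem_cone.2 h⟩
  rw [e2 _ (hA.image _), e2 A hA, e1, Set.ncard_image_of_injective _ (mul_right_injective _)]
  simp only [e3]
  split_ifs <;> omega

/-- The vertices that a tour realising `z` has to visit. -/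
def sites (z : Lamplighter q) : Set (Tree q) := insert z.pos (z.lamp.support : Set (Tree q))

theorem sites_finite (z : Lamplighter q) : (sites z).Finite := z.lamp.support.finite_toSet.insert _

/-- The explicit length of `z`: number of lamps plus the length of a shortest tour. -/
def tourLength (z : Lamplighter q) : ℕ :=
  z.lamp.support.card + 2 * (hull (sites z)).ncard - (hull {z.pos}).ncard

/-- Guarantees that the natural-number subtraction in `tourLength` does not truncate. -/
theorem ncard_hull_pos_le (z : Lamplighter q) : (hull {z.pos}).ncard ≤ (hull (sites z)).ncard :=
  Set.ncard_le_ncard (hull_mono (by simp [sites])) (hull_finite (sites_finite z))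

/-- The root lies in no cone but its own. This is why toggling the root lamp leaves the travelling
part of the tour unchanged. -/
theorem hull_insert_one (A : Set (Tree q)) : hull (insert 1 A) = hull A := by
  ext w
  simp only [hull, Set.mem_ofPred_eq]
  refine and_congr_right fun hw => ⟨?_, fun h => h.mono (by gcongr; simp)⟩
  rintro ⟨v, rfl | hv, h⟩
  · exfalso; apply hw; simpa [cone, letters_one, letters_eq_nil] using h
  · exact ⟨v, hv, h⟩

theorem move_mul_pos (a : Fin q) (z : Lamplighter q) : (moveGen a * z).pos = gen a * z.pos := rfl

theorem move_mul_lamp (a : Fin q) (z : Lamplighter q) (w : Tree q) :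
    (moveGen a * z).lamp w = z.lamp (gen a * w) := by
  simp [moveGen, lamp_mul, shift_apply, gen_inv]

theorem switch_mul_pos (z : Lamplighter q) : (switchGen q * z).pos = z.pos := by
  simp [switchGen, pos_mul]

theorem switch_mul_lamp (z : Lamplighter q) (w : Tree q) :
    (switchGen q * z).lamp w = (if w = 1 then 1 else 0) + z.lamp w := by
  simp [switchGen, lamp_mul, shift_apply, Finsupp.single_apply, eq_comm]

theorem sites_move (a : Fin q) (z : Lamplighter q) :
    sites (moveGen a * z) = (gen a * ·) '' sites z := by
  ext w
  have h2 : w ∈ (gen a * ·) '' sites z ↔ gen a * w ∈ sites z := by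
    constructor
    · rintro ⟨v, hv, rfl⟩; simpa [gen_mul_cancel] using hv
    · intro h; exact ⟨_, h, gen_mul_cancel a w⟩
  rw [h2]
  have : w = gen a * z.pos ↔ gen a * w = z.pos := by
    constructor <;> intro h
    · rw [h, gen_mul_cancel]
    · rw [← h, gen_mul_cancel]
  simp [sites, move_mul_pos, move_mul_lamp, this]

/-- The condition under which moving along `a` first makes the tour longer. -/
def MoveUp (a : Fin q) (z : Lamplighter q) : Prop :=
  (z.pos ∈ cone (gen a) ∧ ∃ w ∉ cone (gen a), z.lamp w ≠ 0) ∨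
    (z.pos ∉ cone (gen a) ∧ ∀ w ∈ cone (gen a), z.lamp w = 0)

-- Only the edge between the root and `a` is used differently after the translation. If the position
-- is in the cone, one traversal becomes two or none, according to whether a lamp outside is lit. If
-- it is not, two or no traversals become one.
open Classical in
theorem tourLength_move (a : Fin q) (z : Lamplighter q) :
    (tourLength (moveGen a * z) : ℤ) = tourLength z + if MoveUp a z then 1 else -1 := by
  have h1 := ncard_hull_gen_mul a (sites_finite z)
  have h2 := ncard_hull_gen_mul a (Set.finite_singleton z.pos)
  have h3 := ncard_hull_pos_le z
  have h4 := ncard_hull_pos_le (moveGen a * z)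
  have h5 : (moveGen a * z).lamp.support.card = z.lamp.support.card := by
    rw [← Finset.card_map (Equiv.mulLeft (gen a)).toEmbedding]
    congr 1
    ext w
    simp [move_mul_lamp, gen_inv, gen_mul_cancel]
  rw [← sites_move] at h1
  rw [Set.image_singleton, ← move_mul_pos] at h2
  unfold tourLength
  rw [h5]
  have e1 : ({z.pos} ∩ cone (gen a)).Nonempty ↔ z.pos ∈ cone (gen a) := by simp
  have e2 : {z.pos} ⊆ cone (gen a) ↔ z.pos ∈ cone (gen a) := by simp
  simp only [e1, e2] at h2
  have e3 : sites z ⊆ cone (gen a) ↔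
      z.pos ∈ cone (gen a) ∧ ¬ ∃ w ∉ cone (gen a), z.lamp w ≠ 0 := by
    simp only [sites, Set.insert_subset_iff]
    refine and_congr_right fun _ => ?_
    push Not
    refine forall_congr' fun w => ?_
    rw [Finset.mem_coe, Finsupp.mem_support_iff]
    tauto
  have e4 : (sites z ∩ cone (gen a)).Nonempty ↔
      z.pos ∈ cone (gen a) ∨ ¬ ∀ w ∈ cone (gen a), z.lamp w = 0 := by
    constructor
    · rintro ⟨w, rfl | hw, h⟩
      · exact Or.inl h
      · refine Or.inr fun h' => ?_
        rw [Finset.mem_coe, Finsupp.mem_support_iff] at hw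
        exact hw (h' w h)
    · rintro (h | h)
      · exact ⟨z.pos, Or.inl rfl, h⟩
      · push Not at h
        obtain ⟨w, hw, h⟩ := h
        exact ⟨w, Or.inr (by simpa using h), hw⟩
  simp only [e3, e4] at h1
  unfold MoveUp
  clear e1 e2 e3 e4
  generalize (∃ w ∉ cone (gen a), z.lamp w ≠ 0) = E at *
  generalize (∀ w ∈ cone (gen a), z.lamp w = 0) = F at *
  generalize (z.pos ∈ cone (gen a)) = C at *
  by_cases c1 : C <;> by_cases c2 : E <;> by_cases c3 : F <;> simp [c1, c2, c3] at h1 h2 ⊢ <;>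
    omega

theorem zmod_two_cases (c : ZMod 2) : c = 0 ∨ c = 1 := by revert c; decide

open Classical in
theorem tourLength_switch (z : Lamplighter q) :
    (tourLength (switchGen q * z) : ℤ) = tourLength z + if z.lamp 1 = 0 then 1 else -1 := by
  have h3 := ncard_hull_pos_le z
  have hull_eq : ∀ y : Lamplighter q, hull (sites y) = hull (insert 1 (sites y)) :=
    fun y => (hull_insert_one _).symm
  have h4 : insert 1 (sites (switchGen q * z)) = insert 1 (sites z) := by
    ext w
    by_cases hw : w = 1
    · simp [hw]
    · simp [hw, sites, switch_mul_pos, switch_mul_lamp]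
  unfold tourLength
  rw [hull_eq (switchGen q * z), h4, ← hull_eq, switch_mul_pos]
  rcases zmod_two_cases (z.lamp 1) with h | h
  · have : (switchGen q * z).lamp.support = insert 1 z.lamp.support := by
      ext w
      by_cases hw : w = 1
      · simp [hw, switch_mul_lamp, h]
      · simp [hw, switch_mul_lamp]
    rw [this, Finset.card_insert_of_notMem (by simp [h])]
    simp [h]; omega
  · have : z.lamp.support = insert 1 (switchGen q * z).lamp.support := by
      ext w
      by_cases hw : w = 1
      · simp [hw, h]
      · simp [hw, switch_mul_lamp]
    rw [this, Finset.card_insert_of_notMem]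
    · simp [h]; omega
    · simp [switch_mul_lamp, h]; decide

/-! ### Identification of the tour length with the Cayley distance -/

/-- The generator of the lamplighter group belonging to a step: `none` stands for switching. -/
def toGen : Option (Fin q) → Lamplighter q
  | none => switchGen q
  | some i => moveGen i

open Classical in
/-- The change of length under left multiplication by a generator. -/
def lengthChange (s : Option (Fin q)) (z : Lamplighter q) : ℤ :=
  match s with
  | none => if z.lamp 1 = 0 then 1 else -1
  | some a => if MoveUp a z then 1 else -1

theorem tourLength_toGen (s : Option (Fin q)) (z : Lamplighter q) :
    (tourLength (toGen s * z) : ℤ) = tourLength z + lengthChange s z := by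
  cases s
  · exact tourLength_switch z
  · exact tourLength_move _ z

theorem abs_lengthChange (s : Option (Fin q)) (z : Lamplighter q) : |lengthChange s z| = 1 := by
  cases s <;> simp only [lengthChange] <;> split_ifs <;> simp

/-- An optimal first step: switch off a lit root lamp; otherwise walk towards a lit lamp lying in a
branch without the final position; if there is none, walk towards the final position. -/
theorem exists_lengthChange_neg {z : Lamplighter q} (hz : z ≠ 1) :
    ∃ s, lengthChange s z = -1 := by
  by_cases h0 : z.lamp 1 = 0
  swap
  · exact ⟨none, by simp [lengthChange, h0]⟩
  have first : ∀ x : Tree q, x ≠ 1 → ∃ a, x ∈ cone (gen a) := by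
    intro x hx
    cases hl : letters x with
    | nil => exact absurd (letters_eq_nil.1 hl) hx
    | cons a l => exact ⟨a, by simp [mem_cone_gen, hl]⟩
  have disj : ∀ (x : Tree q) a b, x ∈ cone (gen a) → x ∈ cone (gen b) → a = b := by
    intro x a b h1 h2
    rw [mem_cone_gen] at h1 h2
    rw [h1] at h2; simpa using h2
  suffices ∃ a, ¬ MoveUp a z by
    obtain ⟨a, ha⟩ := this
    exact ⟨some a, by simp [lengthChange, ha]⟩
  by_cases hx : z.pos = 1
  · obtain ⟨w, hw⟩ : ∃ w, z.lamp w ≠ 0 := by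
      by_contra! h
      exact hz (Lamplighter.ext (Finsupp.ext h) hx)
    obtain ⟨a, ha⟩ := first w (by rintro rfl; exact hw h0)
    refine ⟨a, ?_⟩
    rintro (⟨h, -⟩ | ⟨-, h⟩)
    · rw [hx] at h; exact one_notMem_cone a h
    · exact hw (h w ha)
  · obtain ⟨a, ha⟩ := first _ hx
    by_cases hA : ∃ w ∉ cone (gen a), z.lamp w ≠ 0
    · obtain ⟨w, hw, hw'⟩ := hA
      obtain ⟨b, hb⟩ := first w (by rintro rfl; exact hw' h0)
      refine ⟨b, ?_⟩
      rintro (⟨h, -⟩ | ⟨-, h⟩)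
      · rw [disj _ _ _ h ha] at hb; exact hw hb
      · exact hw' (h w hb)
    · refine ⟨a, ?_⟩
      rintro (⟨-, h⟩ | ⟨h, -⟩)
      · exact hA h
      · exact h ha

theorem tourLength_one : tourLength (1 : Lamplighter q) = 0 := by
  have : hull {(1 : Tree q)} = ∅ := by
    have := hull_insert_one (∅ : Set (Tree q))
    simpa [hull] using this
  simp [tourLength, sites, lamp_one, pos_one, this]

theorem toGen_mul_self (s : Option (Fin q)) : toGen s * toGen s = 1 := by
  cases s with
  | none =>
    ext w
    · change (switchGen q * switchGen q).lamp w = _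
      rw [switch_mul_lamp]
      by_cases h : w = 1
      · simp [switchGen, lamp_one, h]; decide
      · simp [switchGen, lamp_one, h]
    · simp [toGen, switchGen, pos_mul, pos_one]
  | some i =>
    ext w
    · change (moveGen i * moveGen i).lamp w = _
      rw [move_mul_lamp]; simp [moveGen, lamp_one]
    · exact gen_mul_self i

theorem mem_generators {g : Lamplighter q} : g ∈ generators q ↔ ∃ s, g = toGen s := by
  constructor
  · rintro (rfl | ⟨i, rfl⟩)
    · exact ⟨none, rfl⟩
    · exact ⟨some i, rfl⟩
  · rintro ⟨_ | i, rfl⟩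
    · exact Or.inl rfl
    · exact Or.inr ⟨i, rfl⟩

theorem adj_mulCayley_iff {u v : Lamplighter q} :
    (SimpleGraph.mulCayley (generators q)).Adj u v ↔ u ≠ v ∧ ∃ s, u * toGen s = v := by
  rw [SimpleGraph.mulCayley_adj']
  refine and_congr_right fun _ => ?_
  constructor
  · rintro ⟨g, hg, h⟩
    obtain ⟨s, rfl⟩ := mem_generators.1 hg
    refine ⟨s, ?_⟩
    rcases h with h | h
    · exact h
    · rw [h, mul_assoc, toGen_mul_self, mul_one]
  · rintro ⟨s, h⟩
    exact ⟨_, mem_generators.2 ⟨s, rfl⟩, Or.inl h⟩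

theorem toGen_ne_one (s : Option (Fin q)) : toGen s ≠ 1 := by
  intro h
  have h1 := tourLength_toGen s 1
  have h2 := abs_lengthChange s 1
  rw [mul_one, h] at h1
  have : lengthChange s (1 : Lamplighter q) = 0 := by omega
  simp [this] at h2

/-- A shortening generator is put in front of a walk obtained by induction. Edges are right
multiplications, so left multiplication by that generator is a graph homomorphism `φ` carrying the
shorter walk to its new place. -/
theorem exists_walk_tourLength (n : ℕ) : ∀ z : Lamplighter q, tourLength z = n →
    ∃ w : (SimpleGraph.mulCayley (generators q)).Walk 1 z, w.length = n := by
  induction n with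
  | zero =>
    intro z hz
    by_cases h : z = 1
    · subst h; exact ⟨.nil, rfl⟩
    · obtain ⟨s, hs⟩ := exists_lengthChange_neg h
      have := tourLength_toGen s z
      omega
  | succ n ih =>
    intro z hz
    have h : z ≠ 1 := by rintro rfl; simp [tourLength_one] at hz
    obtain ⟨s, hs⟩ := exists_lengthChange_neg h
    have h1 := tourLength_toGen s z
    obtain ⟨w, hw⟩ := ih (toGen s * z) (by omega)
    let φ : SimpleGraph.mulCayley (generators q) →g SimpleGraph.mulCayley (generators q) :=
      { toFun := fun u => toGen s * u
        map_rel' := by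
          intro a b hab
          rw [adj_mulCayley_iff] at hab ⊢
          obtain ⟨h1, s', rfl⟩ := hab
          exact ⟨by simpa using h1, s', by rw [mul_assoc]⟩ }
    have e1 : φ 1 = toGen s := mul_one _
    have e2 : φ (toGen s * z) = z := by
      change toGen s * (toGen s * z) = z
      rw [← mul_assoc, toGen_mul_self, one_mul]
    have hadj : (SimpleGraph.mulCayley (generators q)).Adj 1 (φ 1) := by
      rw [adj_mulCayley_iff, e1]
      exact ⟨(toGen_ne_one s).symm, s, one_mul _⟩
    exact ⟨(SimpleGraph.Walk.cons hadj (w.map φ)).copy rfl e2, by simp [hw]⟩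

theorem tourLength_le_walk {u v : Lamplighter q}
    (w : (SimpleGraph.mulCayley (generators q)).Walk u v) : tourLength (u⁻¹ * v) ≤ w.length := by
  induction w with
  | nil => simp [tourLength_one]
  | @cons u u' v h p ih =>
    obtain ⟨_, s, rfl⟩ := adj_mulCayley_iff.1 h
    have h1 := tourLength_toGen s ((u * toGen s)⁻¹ * v)
    have h2 := (abs_le.1 (abs_lengthChange s ((u * toGen s)⁻¹ * v)).le).2
    rw [show toGen s * ((u * toGen s)⁻¹ * v) = u⁻¹ * v by group] at h1
    rw [SimpleGraph.Walk.length_cons]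
    omega

theorem length_eq_tourLength (z : Lamplighter q) : length z = tourLength z := by
  obtain ⟨w, hw⟩ := exists_walk_tourLength _ z rfl
  unfold length
  rw [SimpleGraph.dist_comm]
  refine le_antisymm (hw ▸ SimpleGraph.dist_le w) ?_
  obtain ⟨w', hw'⟩ := w.reachable.exists_walk_length_eq_dist
  rw [← hw']
  simpa using tourLength_le_walk w'

theorem length_toGen_mul (s : Option (Fin q)) (z : Lamplighter q) :
    (length (toGen s * z) : ℤ) = length z + lengthChange s z := by
  rw [length_eq_tourLength, length_eq_tourLength, tourLength_toGen]

theorem length_toGen_mul_le (s : Option (Fin q)) (z : Lamplighter q) :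
    length (toGen s * z) ≤ length z + 1 := by
  have h1 := length_toGen_mul s z
  have h2 := (abs_le.1 (abs_lengthChange s z).le).2
  omega

theorem length_one : length (1 : Lamplighter q) = 0 := by
  rw [length_eq_tourLength, tourLength_one]

/-- Induction on the length of `y`: a shortening generator is peeled off the left of `y` and costs
at most one when put back. -/
theorem length_mul_le (y z : Lamplighter q) : length (y * z) ≤ length y + length z := by
  induction h : length y using Nat.strong_induction_on generalizing y with
  | _ n ih =>
    by_cases hy : y = 1
    · subst hy; simp
    · obtain ⟨s, hs⟩ := exists_lengthChange_neg hy
      have h1 := length_toGen_mul s y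
      have h2 := ih (length (toGen s * y)) (by omega) (toGen s * y) rfl
      have h3 := length_toGen_mul_le s (toGen s * y * z)
      rw [show toGen s * (toGen s * y * z) = y * z by
        rw [← mul_assoc, ← mul_assoc, toGen_mul_self, one_mul]] at h3
      omega

/-! ### Sequences of steps -/

/-- Sequences of steps; `none` stands for switching, `some i` for moving along `i`. -/
abbrev Steps (q : ℕ) : Type := ℕ → Option (Fin q)

instance : MeasurableSpace (Option (Fin q)) := ⊤

instance : DiscreteMeasurableSpace (Option (Fin q)) := ⟨fun _ => trivial⟩

/-- The sequence without its first `n` steps. -/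
def shiftBy (n : ℕ) (s : Steps q) : Steps q := fun k => s (k + n)

/-- The sequence with one more step in front. -/
def consStep (x : Option (Fin q)) (s : Steps q) : Steps q
  | 0 => x
  | n + 1 => s n

/-- The path in the lamplighter group driven by a sequence of steps. -/
def traj (s : Steps q) : ℕ → Lamplighter q
  | 0 => 1
  | n + 1 => traj s n * toGen (s n)

theorem shiftBy_zero (s : Steps q) : shiftBy 0 s = s := rfl

theorem shiftBy_shiftBy (m n : ℕ) (s : Steps q) : shiftBy m (shiftBy n s) = shiftBy (m + n) s := by
  funext k; simp [shiftBy, add_assoc]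

theorem traj_add (s : Steps q) (n m : ℕ) : traj s (n + m) = traj s n * traj (shiftBy n s) m := by
  induction m with
  | zero => simp [traj]
  | succ m ih =>
    rw [← add_assoc, traj, ih, traj, mul_assoc]
    simp [shiftBy, add_comm]

theorem traj_one (s : Steps q) : traj s 1 = toGen (s 0) := by simp [traj]

theorem traj_succ' (s : Steps q) (n : ℕ) :
    traj s (n + 1) = toGen (s 0) * traj (shiftBy 1 s) n := by
  rw [add_comm, traj_add, traj_one]

theorem traj_consStep (x : Option (Fin q)) (s : Steps q) (n : ℕ) :
    traj (consStep x s) (n + 1) = toGen x * traj s n := traj_succ' _ _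

theorem traj_congr {s t : Steps q} {n : ℕ} (h : ∀ k < n, s k = t k) : traj s n = traj t n := by
  induction n with
  | zero => rfl
  | succ n ih => rw [traj, traj, ih fun k hk => h k (by omega), h n (by omega)]

theorem length_traj_le (s : Steps q) (n : ℕ) : length (traj s n) ≤ n := by
  induction n generalizing s with
  | zero => simp [traj, length_one]
  | succ n ih =>
    rw [traj_succ']
    exact (length_toGen_mul_le _ _).trans (by simpa using ih _)

@[fun_prop]
theorem measurable_shiftBy (n : ℕ) : Measurable (shiftBy n : Steps q → Steps q) :=
  measurable_pi_lambda _ fun k => measurable_pi_apply (k + n)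

@[fun_prop]
theorem measurable_consStep (x : Option (Fin q)) : Measurable (consStep x) := by
  refine measurable_pi_lambda _ fun k => ?_
  cases k with
  | zero => exact measurable_const
  | succ k => exact measurable_pi_apply k

/-- Functions of finitely many steps are measurable. -/
theorem measurable_of_prefix {α : Type*} [MeasurableSpace α] (n : ℕ) (f : Steps q → α)
    (hf : ∀ s t : Steps q, (∀ k < n, s k = t k) → f s = f t) : Measurable f := by
  have : f = (fun u : Fin n → Option (Fin q) =>
      f fun k => if h : k < n then u ⟨k, h⟩ else none) ∘ fun s i => s i := by
    funext s
    apply hf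
    intro k hk
    simp [hk]
  rw [this]
  exact (measurable_of_countable _).comp (by fun_prop)

theorem measurable_traj_comp {α : Type*} [MeasurableSpace α] (n : ℕ) (f : Lamplighter q → α) :
    Measurable fun s => f (traj s n) :=
  measurable_of_prefix n _ fun s t h => by rw [traj_congr h]

theorem measurableSet_traj (n : ℕ) (φ : Lamplighter q → Prop) :
    MeasurableSet {s | φ (traj s n)} :=
  measurableSet_setOfPred.2 (measurable_traj_comp n φ)

theorem measurableSet_eventually {α : Type*} [MeasurableSpace α] {φ : ℕ → α → Prop}
    (h : ∀ n, MeasurableSet {s | φ n s}) : MeasurableSet {s | ∀ᶠ n in atTop, φ n s} := by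
  have : {s | ∀ᶠ n in atTop, φ n s} = ⋃ N, ⋂ n, ⋂ (_ : N ≤ n), {s | φ n s} := by
    ext s; simp [eventually_atTop]
  rw [this]
  exact .iUnion fun N => .iInter fun n => .iInter fun _ => h n

/-! ### The product measure -/

/-- The law of an i.i.d. sequence of steps. -/
def seqLaw (μ : Measure (Option (Fin q))) [IsProbabilityMeasure μ] : Measure (Steps q) :=
  Measure.infinitePi fun _ => μ

variable (μ : Measure (Option (Fin q))) [IsProbabilityMeasure μ]

instance : IsProbabilityMeasure (seqLaw μ) := by unfold seqLaw; infer_instance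

theorem seqLaw_map_shiftBy (n : ℕ) : (seqLaw μ).map (shiftBy n) = seqLaw μ := by
  exact Measure.map_infinitePi_infinitePi_of_inj (P := fun _ : ℕ => μ) (add_left_injective n)

theorem measurePreserving_shiftBy (n : ℕ) :
    MeasurePreserving (shiftBy n) (seqLaw μ) (seqLaw μ) :=
  ⟨measurable_shiftBy n, seqLaw_map_shiftBy μ n⟩

/-- Padding the missing coordinates with `Set.univ` turns any finite box into one on an initial
segment, so initial boxes suffice to identify the product law. -/
theorem box_eq (S : Finset ℕ) (t : ℕ → Set (Option (Fin q))) : ∃ (N : ℕ)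
    (t' : ℕ → Set (Option (Fin q))), (S : Set ℕ).pi t = {s | ∀ i < N, s i ∈ t' i} ∧
      ∏ i ∈ S, μ (t i) = ∏ i ∈ Finset.range N, μ (t' i) := by
  classical
  refine ⟨S.sup id + 1, fun i => if i ∈ S then t i else Set.univ, ?_, ?_⟩
  · ext s
    simp only [Set.mem_pi, Finset.mem_coe, Set.mem_ofPred_eq]
    constructor
    · intro h i _
      by_cases hi : i ∈ S
      · simpa [hi] using h i hi
      · simp [hi]
    · intro h i hi
      have := h i (Nat.lt_succ_of_le (Finset.le_sup (f := id) hi))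
      simpa [hi] using this
  · have : S ⊆ Finset.range (S.sup id + 1) := fun i hi =>
      Finset.mem_range.2 (Nat.lt_succ_of_le (Finset.le_sup (f := id) hi))
    rw [← Finset.prod_subset this (fun i _ hi => by simp [hi])]
    exact Finset.prod_congr rfl fun i hi => by simp [hi]

theorem seqLaw_box (N : ℕ) (t : ℕ → Set (Option (Fin q))) :
    seqLaw μ {s | ∀ i < N, s i ∈ t i} = ∏ i ∈ Finset.range N, μ (t i) := by
  have : {s : Steps q | ∀ i < N, s i ∈ t i} = ((Finset.range N : Finset ℕ) : Set ℕ).pi t := by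
    ext s; simp
  rw [this, seqLaw, Measure.infinitePi_pi _ fun _ _ => .of_discrete]

theorem eq_seqLaw {ν : Measure (Steps q)}
    (h : ∀ (N : ℕ) (t : ℕ → Set (Option (Fin q))),
      ν {s | ∀ i < N, s i ∈ t i} = ∏ i ∈ Finset.range N, μ (t i)) : ν = seqLaw μ := by
  refine Measure.eq_infinitePi _ fun S t _ => ?_
  obtain ⟨N, t', h1, h2⟩ := box_eq μ S t
  rw [h1, h2, h]

theorem measurableSet_box (N : ℕ) (t : ℕ → Set (Option (Fin q))) :
    MeasurableSet {s : Steps q | ∀ i < N, s i ∈ t i} :=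
  measurableSet_setOfPred.2 (measurable_of_prefix N _ fun s s' h => by
    refine propext (forall₂_congr fun i hi => ?_)
    rw [h i hi])

/-- Decomposition according to the first step. -/
theorem seqLaw_eq_sum : seqLaw μ = ∑ x, μ {x} • (seqLaw μ).map (consStep x) := by
  classical
  symm
  refine eq_seqLaw μ fun N t => ?_
  simp only [Measure.coe_finsetSum, Finset.sum_apply, Measure.smul_apply, smul_eq_mul]
  simp_rw [Measure.map_apply (measurable_consStep _) (measurableSet_box N t)]
  cases N with
  | zero => simp
  | succ N =>
    have : ∀ x, (seqLaw μ) (consStep x ⁻¹' {s | ∀ i < N + 1, s i ∈ t i}) =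
        if x ∈ t 0 then ∏ i ∈ Finset.range N, μ (t (i + 1)) else 0 := by
      intro x
      split_ifs with hx
      · rw [← seqLaw_box]
        congr 1
        ext s
        constructor
        · intro h i hi
          exact h (i + 1) (by omega)
        · intro h i hi
          cases i with
          | zero => exact hx
          | succ i => exact h i (by omega)
      · convert measure_empty
        · ext s
          simp only [Set.mem_preimage, Set.mem_ofPred_eq, Set.mem_empty_iff_false, iff_false]
          exact fun h => hx (h 0 (by omega))
        · infer_instance
    simp_rw [this, mul_ite, mul_zero]
    rw [← Finset.sum_filter, ← Finset.sum_mul, sum_measure_singleton, Finset.prod_range_succ',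
      mul_comm]
    congr 2
    ext x; simp

theorem seqLaw_apply_eq_sum {B : Set (Steps q)} (hB : MeasurableSet B) :
    seqLaw μ B = ∑ x, μ {x} * seqLaw μ (consStep x ⁻¹' B) := by
  conv_lhs => rw [seqLaw_eq_sum]
  simp only [Measure.coe_finsetSum, Finset.sum_apply, Measure.smul_apply, smul_eq_mul]
  simp_rw [Measure.map_apply (measurable_consStep _) hB]

theorem seqLaw_real_eq_sum {B : Set (Steps q)} (hB : MeasurableSet B) :
    (seqLaw μ).real B = ∑ x, μ.real {x} * (seqLaw μ).real (consStep x ⁻¹' B) := by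
  rw [measureReal_def, seqLaw_apply_eq_sum μ hB, ENNReal.toReal_sum]
  · simp [measureReal_def]
  · exact fun x _ => ENNReal.mul_ne_top (measure_ne_top _ _) (measure_ne_top _ _)

theorem integral_seqLaw_eq_sum {f : Steps q → ℝ} (hf : Measurable f) {C : ℝ}
    (hC : ∀ s, |f s| ≤ C) :
    ∫ s, f s ∂seqLaw μ = ∑ x, μ.real {x} * ∫ s, f (consStep x s) ∂seqLaw μ := by
  conv_lhs => rw [seqLaw_eq_sum]
  rw [integral_finsetSum_measure]
  · refine Finset.sum_congr rfl fun x _ => ?_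
    rw [integral_smul_measure, integral_map (by fun_prop) hf.aestronglyMeasurable]
    rfl
  · intro x _
    have : IsProbabilityMeasure ((seqLaw μ).map (consStep x)) :=
      Measure.isProbabilityMeasure_map (by fun_prop)
    refine Integrable.smul_measure ?_ (measure_ne_top _ _)
    exact Integrable.of_bound hf.aestronglyMeasurable C (ae_of_all _ fun s => hC s)

/-- The set `A` is determined by the first `n` steps. -/
def DeterminedBy (n : ℕ) (A : Set (Steps q)) : Prop :=
  ∀ s t : Steps q, (∀ k < n, s k = t k) → (s ∈ A ↔ t ∈ A)

theorem DeterminedBy.measurableSet {n : ℕ} {A : Set (Steps q)} (h : DeterminedBy n A) :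
    MeasurableSet A :=
  measurableSet_setOfPred.2 (measurable_of_prefix n _ fun s t hst => propext (h s t hst))

/-- The future is independent of the past. -/
theorem seqLaw_inter_shiftBy {n : ℕ} {A : Set (Steps q)} (hA : DeterminedBy n A)
    {B : Set (Steps q)} (hB : MeasurableSet B) :
    seqLaw μ (A ∩ shiftBy n ⁻¹' B) = seqLaw μ A * seqLaw μ B := by
  induction n generalizing A with
  | zero =>
    by_cases h : A.Nonempty
    · obtain ⟨s, hs⟩ := h
      have : A = Set.univ := Set.eq_univ_of_forall fun t => (hA s t (by simp)).1 hs
      subst this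
      simp only [Set.univ_inter, measure_univ, one_mul]
      rfl
    · rw [Set.not_nonempty_iff_eq_empty] at h
      simp [h]
  | succ n ih =>
    rw [seqLaw_apply_eq_sum μ (hA.measurableSet.inter (measurable_shiftBy _ hB)),
      seqLaw_apply_eq_sum μ hA.measurableSet, Finset.sum_mul]
    refine Finset.sum_congr rfl fun x _ => ?_
    rw [mul_assoc, ← ih (A := consStep x ⁻¹' A)]
    · rfl
    · intro s t h
      refine hA _ _ fun k hk => ?_
      cases k with
      | zero => rfl
      | succ k => exact h k (by omega)

/-- Zero-one law for events that are invariant under the shift. -/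
theorem seqLaw_zero_or_one {A : Set (Steps q)} (hA : MeasurableSet A)
    (hinv : shiftBy 1 ⁻¹' A = A) : seqLaw μ A = 0 ∨ seqLaw μ A = 1 := by
  by_cases h0 : seqLaw μ A = 0
  · exact Or.inl h0
  right
  have hn : ∀ n, shiftBy n ⁻¹' A = A := by
    intro n
    induction n with
    | zero => rfl
    | succ n ih =>
      have : shiftBy (n + 1) = (shiftBy n : Steps q → Steps q) ∘ shiftBy 1 := by
        funext s; exact (shiftBy_shiftBy n 1 s).symm
      rw [this, Set.preimage_comp, ih, hinv]
  -- Invariance makes `A` an event of the future of every time `N`, hence independent of every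
  -- initial box. Conditioning on `A` then leaves the law unchanged, although the conditioned law
  -- does not charge `Aᶜ`.
  have key : (seqLaw μ A)⁻¹ • (seqLaw μ).restrict A = seqLaw μ := by
    refine eq_seqLaw μ fun N t => ?_
    rw [Measure.smul_apply, Measure.restrict_apply (measurableSet_box N t)]
    nth_rw 2 [← hn N]
    rw [seqLaw_inter_shiftBy μ (n := N) _ hA, seqLaw_box, smul_eq_mul, mul_comm, mul_assoc,
      ENNReal.mul_inv_cancel h0 (measure_ne_top _ _), mul_one]
    intro s s' h
    refine forall₂_congr fun i hi => ?_
    rw [h i hi]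
  have h1 : seqLaw μ Aᶜ = 0 := by
    rw [← key, Measure.smul_apply, Measure.restrict_apply hA.compl]
    simp
  rwa [prob_compl_eq_zero_iff hA] at h1

/-! ### Transience -/

/-- The step distribution of the lamplighter walk. -/
structure IsStepLaw (p : ℝ) (μ : Measure (Option (Fin q))) : Prop where
  three_le : 3 ≤ q
  pos : 0 < p
  lt_one : p < 1
  none : μ.real {none} = p
  some : ∀ i, μ.real {some i} = (1 - p) / q

/-- The walk finally leaves every ball. -/
def Transient (s : Steps q) : Prop := ∀ k, ∀ᶠ n in atTop, k < (letters (traj s n).pos).length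

/-- A function of the vertices that decays exponentially along the walk. -/
def decay (x : Tree q) : ℝ := (3 / 4 : ℝ) ^ (letters x).length

theorem decay_pos (x : Tree q) : 0 < decay x := by unfold decay; positivity

theorem decay_le_one (x : Tree q) : decay x ≤ 1 :=
  pow_le_one₀ (by norm_num) (by norm_num)

/-- The constant is `7/12 = 4/3 - 3/4`, the excess factor of the one generator that shortens the
word. -/
theorem decay_gen_mul_le (i : Fin q) (x : Tree q) : decay (gen i * x) ≤
    (3 / 4 + if (letters x).head? = some i then 7 / 12 else 0) * decay x := by
  unfold decay
  rcases length_gen_mul x i with ⟨h1, h2⟩ | ⟨h1, h2⟩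
  · rw [h1, if_neg h2, pow_succ]; linarith
  · rw [h1, if_pos h2, pow_succ]
    have : (0 : ℝ) < (3 / 4 : ℝ) ^ (letters (gen i * x)).length := by positivity
    linarith

/-- At most one generator shortens `x`, so the sum is at most `(3q/4 + 7/12)` times `decay x`;
`17/18` is the resulting average factor at the worst case `q = 3`. -/
theorem sum_decay_gen_mul_le (hq : 3 ≤ q) (x : Tree q) :
    ∑ i, decay (gen i * x) ≤ 17 / 18 * q * decay x := by
  refine (Finset.sum_le_sum fun i _ => decay_gen_mul_le i x).trans ?_
  rw [← Finset.sum_mul]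
  refine mul_le_mul_of_nonneg_right ?_ (decay_pos x).le
  rw [Finset.sum_add_distrib]
  have h1 : ∑ i : Fin q, (if (letters x).head? = some i then (7 / 12 : ℝ) else 0) ≤ 7 / 12 := by
    cases (letters x).head? with
    | none => simp; norm_num
    | some a => simp
  have h2 : (3 : ℝ) ≤ q := by exact_mod_cast hq
  simp only [Finset.sum_const, Finset.card_univ, Fintype.card_fin, nsmul_eq_mul]
  linarith

variable {μ} {p : ℝ}

theorem integral_decay_le (h : IsStepLaw p μ) (n : ℕ) :
    ∫ s, decay (traj s n).pos ∂seqLaw μ ≤ (p + (1 - p) * (17 / 18)) ^ n := by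
  have hq : (0 : ℝ) < q := by exact_mod_cast (by have := h.three_le; omega : 0 < q)
  have hp := h.pos
  have hp1 := h.lt_one
  have hint : ∀ n (g : Tree q), Integrable (fun s => decay (g * (traj s n).pos)) (seqLaw μ) := by
    intro n g
    refine Integrable.of_bound
      (measurable_traj_comp n fun z => decay (g * z.pos)).aestronglyMeasurable 1
      (ae_of_all _ fun s => ?_)
    rw [Real.norm_eq_abs, abs_of_pos (decay_pos _)]
    exact decay_le_one _
  induction n with
  | zero =>
    refine (integral_mono (by simpa using hint 0 1) (integrable_const 1)
      fun s => decay_le_one _).trans ?_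
    simp
  | succ n ih =>
    rw [integral_seqLaw_eq_sum μ (measurable_traj_comp (n + 1) fun z => decay z.pos) (C := 1)]
    swap
    · intro s
      rw [abs_of_pos (decay_pos _)]
      exact decay_le_one _
    simp only [Fintype.sum_option, traj_consStep, toGen, switch_mul_pos, move_mul_pos, h.none,
      h.some]
    rw [← Finset.mul_sum, ← integral_finsetSum _ fun i _ => hint n _, pow_succ]
    have h2 : ∫ s, ∑ i, decay (gen i * (traj s n).pos) ∂seqLaw μ ≤
        ∫ s, 17 / 18 * q * decay (traj s n).pos ∂seqLaw μ :=
      integral_mono (integrable_finsetSum _ fun i _ => hint n _)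
        (by simpa using (hint n 1).const_mul _) fun s => sum_decay_gen_mul_le h.three_le _
    rw [integral_const_mul] at h2
    calc _ ≤ p * ∫ s, decay (traj s n).pos ∂seqLaw μ + (1 - p) / q *
          (17 / 18 * q * ∫ s, decay (traj s n).pos ∂seqLaw μ) := by
          have : 0 ≤ (1 - p) / q := div_nonneg (by linarith) hq.le
          gcongr
      _ = (∫ s, decay (traj s n).pos ∂seqLaw μ) * (p + (1 - p) * (17 / 18)) := by
          field_simp
      _ ≤ _ := by
          refine mul_le_mul_of_nonneg_right ih ?_
          nlinarith

/-- Markov's inequality for `decay` and its exponentially small mean make the probabilities of being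
within distance `k` of the root summable; Borel–Cantelli concludes. -/
theorem ae_transient (h : IsStepLaw p μ) : ∀ᵐ s ∂seqLaw μ, Transient s := by
  have hp := h.pos
  have hp1 := h.lt_one
  unfold Transient
  rw [ae_all_iff]
  intro k
  have hρ0 : 0 ≤ p + (1 - p) * (17 / 18) := by nlinarith
  have hρ1 : p + (1 - p) * (17 / 18) < 1 := by nlinarith
  have hbound : ∀ n, seqLaw μ {s | (3 / 4 : ℝ) ^ k ≤ decay (traj s n).pos} ≤
      ENNReal.ofReal ((4 / 3) ^ k * (p + (1 - p) * (17 / 18)) ^ n) := by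
    intro n
    have h1 := mul_meas_ge_le_integral_of_nonneg (μ := seqLaw μ)
      (f := fun s => decay (traj s n).pos) (ae_of_all _ fun s => (decay_pos _).le) (by
        refine Integrable.of_bound
          (measurable_traj_comp n fun z => decay z.pos).aestronglyMeasurable 1
          (ae_of_all _ fun s => ?_)
        rw [Real.norm_eq_abs, abs_of_pos (decay_pos _)]
        exact decay_le_one _) ((3 / 4 : ℝ) ^ k)
    have h2 := h1.trans (integral_decay_le h n)
    rw [← ofReal_measureReal]
    refine ENNReal.ofReal_le_ofReal ?_
    have h3 : (4 / 3 : ℝ) ^ k * (3 / 4) ^ k = 1 := by rw [← mul_pow]; norm_num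
    have h4 := mul_le_mul_of_nonneg_left h2 (by positivity : (0 : ℝ) ≤ (4 / 3) ^ k)
    rwa [← mul_assoc, h3, one_mul] at h4
  have hsum : ∑' n, seqLaw μ {s | (3 / 4 : ℝ) ^ k ≤ decay (traj s n).pos} ≠ ⊤ := by
    refine ne_top_of_le_ne_top ?_ (ENNReal.tsum_le_tsum hbound)
    rw [← ENNReal.ofReal_tsum_of_nonneg (fun n => by positivity)
      ((summable_geometric_of_lt_one hρ0 hρ1).mul_left _)]
    exact ENNReal.ofReal_ne_top
  filter_upwards [ae_eventually_notMem hsum] with s hs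
  filter_upwards [hs] with n hn
  by_contra! hk
  exact hn (pow_le_pow_of_le_one (by norm_num) (by norm_num) hk)

/-! ### Limits of transient walks -/

/-- The walk converges to an end in the boundary of `C_a`. -/
def EndsIn (a : Fin q) (s : Steps q) : Prop := ∀ᶠ n in atTop, (traj s n).pos ∈ cone (gen a)

/-- The lamp at `w` is finally on. -/
def LampOn (w : Tree q) (s : Steps q) : Prop := ∀ᶠ n in atTop, (traj s n).lamp w = 1

theorem measurableSet_endsIn (a : Fin q) : MeasurableSet {s | EndsIn a s} :=
  measurableSet_eventually fun n => measurableSet_traj n fun z => z.pos ∈ cone (gen a)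

theorem measurableSet_lampOn (w : Tree q) : MeasurableSet {s | LampOn w s} :=
  measurableSet_eventually fun n => measurableSet_traj n fun z => z.lamp w = 1

theorem pos_succ (s : Steps q) (n : ℕ) :
    (traj s (n + 1)).pos = (traj s n).pos ∨
      ∃ i, (traj s (n + 1)).pos = (traj s n).pos * gen i := by
  rw [traj, pos_mul]
  cases s n with
  | none => left; simp [toGen, switchGen]
  | some i => right; exact ⟨i, rfl⟩

theorem lamp_succ_of_ne {s : Steps q} {n : ℕ} {w : Tree q} (h : (traj s n).pos ≠ w) :
    (traj s (n + 1)).lamp w = (traj s n).lamp w := by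
  rw [traj, lamp_mul, Finsupp.add_apply, shift_apply]
  cases s n with
  | none =>
    have : (1 : Tree q) ≠ (traj s n).pos⁻¹ * w := by
      intro h'; apply h; rwa [eq_inv_mul_iff_mul_eq, mul_one] at h'
    simp [toGen, switchGen, this]
  | some i => simp [toGen, moveGen]

theorem lamp_eq_of_forall_ne {s : Steps q} {w : Tree q} {N n : ℕ} (hn : N ≤ n)
    (h : ∀ k, N ≤ k → k < n → (traj s k).pos ≠ w) : (traj s n).lamp w = (traj s N).lamp w := by
  induction n, hn using Nat.le_induction with
  | base => rfl
  | succ n hn ih =>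
    rw [lamp_succ_of_ne (h n hn (by omega)), ih fun k h1 h2 => h k h1 (by omega)]

theorem lampOn_iff_of_forall_ne {s : Steps q} {w : Tree q} {N : ℕ}
    (h : ∀ k, N ≤ k → (traj s k).pos ≠ w) : LampOn w s ↔ (traj s N).lamp w = 1 := by
  have h1 : ∀ n, N ≤ n → (traj s n).lamp w = (traj s N).lamp w :=
    fun n hn => lamp_eq_of_forall_ne hn fun k hk _ => h k hk
  constructor
  · intro h2
    obtain ⟨n, h3, h4⟩ := (h2.and (eventually_ge_atTop N)).exists
    rw [← h1 n h4, h3]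
  · intro h2
    filter_upwards [eventually_ge_atTop N] with n hn
    rw [h1 n hn, h2]

theorem Transient.eventually_ne {s : Steps q} (hs : Transient s) (w : Tree q) :
    ∃ N, ∀ k, N ≤ k → (traj s k).pos ≠ w := by
  obtain ⟨N, hN⟩ := eventually_atTop.1 (hs (letters w).length)
  refine ⟨N, fun k hk h => ?_⟩
  have := hN k hk
  rw [h] at this
  exact lt_irrefl _ this

theorem Transient.lamp_eventually {s : Steps q} (hs : Transient s) (w : Tree q) :
    (LampOn w s ∧ ∀ᶠ n in atTop, (traj s n).lamp w = 1) ∨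
      (¬ LampOn w s ∧ ∀ᶠ n in atTop, (traj s n).lamp w = 0) := by
  obtain ⟨N, hN⟩ := hs.eventually_ne w
  have h1 := lampOn_iff_of_forall_ne hN
  rcases zmod_two_cases ((traj s N).lamp w) with h | h
  · right
    rw [h1, h]
    refine ⟨by decide, ?_⟩
    filter_upwards [eventually_ge_atTop N] with n hn
    rw [lamp_eq_of_forall_ne hn fun k hk _ => hN k hk, h]
  · left
    exact ⟨h1.2 h, h1.2 h⟩

/-- The prefixes of the position stabilise. -/
theorem Transient.take_eventually {s : Steps q} (hs : Transient s) (k : ℕ) :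
    ∃ l : List (Fin q), l.length = k ∧ ∀ᶠ n in atTop, (letters (traj s n).pos).take k = l := by
  obtain ⟨N, hN⟩ := eventually_atTop.1 (hs k)
  refine ⟨(letters (traj s N).pos).take k, ?_, ?_⟩
  · rw [List.length_take, min_eq_left (hN N le_rfl).le]
  · filter_upwards [eventually_ge_atTop N] with n hn
    induction n, hn using Nat.le_induction with
    | base => rfl
    | succ n hn ih =>
      have h1 := hN n hn
      have h2 := hN (n + 1) (by omega)
      rcases pos_succ s n with h | ⟨i, h⟩
      · rw [h, ih]
      · rw [h] at h2 ⊢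
        rw [take_letters_mul_gen h1.le h2.le, ih]

theorem Transient.exists_endsIn {s : Steps q} (hs : Transient s) : ∃ a, EndsIn a s := by
  obtain ⟨l, h1, h2⟩ := hs.take_eventually 1
  obtain ⟨a, rfl⟩ := List.length_eq_one_iff.1 h1
  refine ⟨a, ?_⟩
  filter_upwards [h2] with n hn
  rw [mem_cone_gen]
  cases hl : letters (traj s n).pos with
  | nil => simp [hl] at hn
  | cons b l => simp [hl] at hn; simp [hn]

theorem EndsIn.unique {s : Steps q} {a b : Fin q} (ha : EndsIn a s) (hb : EndsIn b s) :
    a = b := by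
  obtain ⟨n, h1, h2⟩ := (ha.and hb).exists
  rw [mem_cone_gen] at h1 h2
  rw [h1] at h2
  simpa using h2

theorem Transient.eventually_notMem {s : Steps q} (hs : Transient s) {a : Fin q}
    (ha : ¬ EndsIn a s) : ∀ᶠ n in atTop, (traj s n).pos ∉ cone (gen a) := by
  obtain ⟨b, hb⟩ := hs.exists_endsIn
  filter_upwards [hb] with n hn h
  rw [mem_cone_gen] at hn h
  rw [h] at hn
  obtain rfl : a = b := by simpa using hn
  exact ha hb

/-- The limiting version of `MoveUp`. -/
def MoveUpLim (a : Fin q) (s : Steps q) : Prop :=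
  (EndsIn a s ∧ ∃ w ∉ cone (gen a), LampOn w s) ∨
    (¬ EndsIn a s ∧ ∀ w ∈ cone (gen a), ¬ LampOn w s)

/-- Once the walk stays on one side of the edge to `a`, all lamps on the other side are frozen, and
`MoveUp` only asks about lamps on that other side. -/
theorem Transient.moveUp_iff {s : Steps q} (hs : Transient s) (a : Fin q) :
    ∀ᶠ n in atTop, (MoveUp a (traj s n) ↔ MoveUpLim a s) := by
  have key : ∀ (D : Set (Tree q)) (N : ℕ), (∀ n, N ≤ n → (traj s n).pos ∈ D) → ∀ n, N ≤ n →
      ∀ w, w ∉ D → (LampOn w s ↔ (traj s n).lamp w ≠ 0) := by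
    intro D N h n hn w hw
    rw [lampOn_iff_of_forall_ne (N := n) fun k hk (e : (traj s k).pos = w) =>
      hw (e ▸ h k (hn.trans hk))]
    rcases zmod_two_cases ((traj s n).lamp w) with h | h <;> simp [h]
  by_cases ha : EndsIn a s
  · obtain ⟨N, hN⟩ := eventually_atTop.1 ha
    filter_upwards [eventually_ge_atTop N] with n hn
    have h1 := hN n hn
    simp only [MoveUp, MoveUpLim, h1, ha, true_and, not_true, false_and, or_false]
    refine exists_congr fun w => and_congr_right fun hw => ?_
    exact (key _ N hN n hn w hw).symm
  · obtain ⟨N, hN⟩ := eventually_atTop.1 (hs.eventually_notMem ha)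
    filter_upwards [eventually_ge_atTop N] with n hn
    have h1 := hN n hn
    simp only [MoveUp, MoveUpLim, h1, ha, true_and, not_false_eq_true, false_and, false_or]
    refine forall₂_congr fun w hw => ?_
    rw [key (cone (gen a))ᶜ N hN n hn w (by simpa using hw), not_not]

open Classical in
/-- The limit of the change of length under left multiplication by a generator. -/
def changeLim (x : Option (Fin q)) (s : Steps q) : ℝ :=
  match x with
  | none => if LampOn 1 s then -1 else 1
  | some a => if MoveUpLim a s then 1 else -1

theorem Transient.tendsto_lengthChange {s : Steps q} (hs : Transient s) (x : Option (Fin q)) :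
    Tendsto (fun n => (lengthChange x (traj s n) : ℝ)) atTop (𝓝 (changeLim x s)) := by
  refine tendsto_const_nhds.congr' ?_
  cases x with
  | none =>
    rcases hs.lamp_eventually 1 with ⟨h1, h2⟩ | ⟨h1, h2⟩
    · filter_upwards [h2] with n hn
      simp [changeLim, lengthChange, h1, hn]
    · filter_upwards [h2] with n hn
      simp [changeLim, lengthChange, h1, hn]
  | some a =>
    filter_upwards [hs.moveUp_iff a] with n hn
    by_cases h : MoveUpLim a s <;> simp [changeLim, lengthChange, hn, h]

/-! ### Existence of the speed -/

section Speed

variable (μ : Measure (Option (Fin q))) [IsProbabilityMeasure μ]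

/-- The expected length at time `n`. -/
def meanLength (n : ℕ) : ℝ := ∫ s, (length (traj s n) : ℝ) ∂seqLaw μ

/-- The limit of the expected increments of the length. -/
def speed : ℝ := ∑ x, μ.real {x} * ∫ s, changeLim x s ∂seqLaw μ

variable {μ}

theorem integrable_traj_of_bound (n : ℕ) (f : Lamplighter q → ℝ) {C : ℝ}
    (hC : ∀ s : Steps q, |f (traj s n)| ≤ C) : Integrable (fun s => f (traj s n)) (seqLaw μ) :=
  Integrable.of_bound (measurable_traj_comp n f).aestronglyMeasurable C (ae_of_all _ hC)

theorem integrable_length (n : ℕ) :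
    Integrable (fun s => (length (traj s n) : ℝ)) (seqLaw μ) := by
  refine integrable_traj_of_bound n (fun z => (length z : ℝ)) (C := n) fun s => ?_
  rw [Nat.abs_cast]
  exact_mod_cast length_traj_le s n

theorem integrable_lengthChange (x : Option (Fin q)) (n : ℕ) :
    Integrable (fun s => (lengthChange x (traj s n) : ℝ)) (seqLaw μ) := by
  refine integrable_traj_of_bound n (fun z => (lengthChange x z : ℝ)) (C := 1) fun s => ?_
  exact_mod_cast (abs_lengthChange _ _).le

theorem meanLength_nonneg (n : ℕ) : 0 ≤ meanLength μ n :=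
  integral_nonneg fun _ => Nat.cast_nonneg _

/-- The additional step is inserted in front of the path, not at its end: the increment is then a
function of a generator and of the walk at time `n`, and converges pathwise. -/
theorem meanLength_succ (n : ℕ) : meanLength μ (n + 1) =
    meanLength μ n + ∑ x, μ.real {x} * ∫ s, (lengthChange x (traj s n) : ℝ) ∂seqLaw μ := by
  have hsum : ∑ x, μ.real {x} = 1 := by
    rw [sum_measureReal_singleton]; simp
  unfold meanLength
  rw [integral_seqLaw_eq_sum μ (measurable_traj_comp (n + 1) fun z => (length z : ℝ))
    (C := (n + 1 : ℕ))]
  swap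
  · intro s
    rw [Nat.abs_cast]
    exact_mod_cast length_traj_le s (n + 1)
  have h : ∀ x (s : Steps q), (length (traj (consStep x s) (n + 1)) : ℝ) =
      length (traj s n) + (lengthChange x (traj s n) : ℝ) := by
    intro x s
    rw [traj_consStep]
    exact_mod_cast length_toGen_mul x (traj s n)
  simp_rw [h]
  simp_rw [fun x => integral_add (μ := seqLaw μ) (integrable_length n)
    (integrable_lengthChange x n), mul_add, Finset.sum_add_distrib, ← Finset.sum_mul, hsum,
    one_mul]

variable {p : ℝ}

/-- The increments are bounded by one and converge pathwise on transient paths, so their means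
converge to `speed μ`; `meanLength` is the sum of these means. -/
theorem tendsto_meanLength (h : IsStepLaw p μ) :
    Tendsto (fun n : ℕ => meanLength μ n / n) atTop (𝓝 (speed μ)) := by
  have h1 : Tendsto (fun n => ∑ x, μ.real {x} * ∫ s, (lengthChange x (traj s n) : ℝ) ∂seqLaw μ)
      atTop (𝓝 (speed μ)) := by
    refine tendsto_finsetSum _ fun x _ => Tendsto.const_mul _ ?_
    refine tendsto_integral_of_dominated_convergence (fun _ => 1)
      (fun n => (integrable_lengthChange x n).aestronglyMeasurable) (integrable_const 1)
      (fun n => ae_of_all _ fun s => ?_) ?_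
    · rw [Real.norm_eq_abs]
      exact_mod_cast (abs_lengthChange _ _).le
    · filter_upwards [ae_transient h] with s hs
      exact hs.tendsto_lengthChange x
  refine h1.cesaro.congr fun n => ?_
  rw [div_eq_inv_mul]
  congr 1
  induction n with
  | zero => simp [meanLength, traj, length_one]
  | succ n ih => rw [Finset.sum_range_succ, ih, meanLength_succ]

/-! ### Almost sure upper bound by independent blocks -/

/-- Lengths of the consecutive blocks of `m` steps. -/
def blockLength (m j : ℕ) (s : Steps q) : ℝ := length (traj (shiftBy (j * m) s) m)

theorem length_le_sum_blockLength (m : ℕ) (s : Steps q) (j : ℕ) :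
    (length (traj s (j * m)) : ℝ) ≤ ∑ i ∈ Finset.range j, blockLength m i s := by
  induction j with
  | zero => simp [traj, length_one]
  | succ j ih =>
    rw [Finset.sum_range_succ, add_mul, one_mul, traj_add]
    have h1 : (length (traj s (j * m) * traj (shiftBy (j * m) s) m) : ℝ) ≤
        length (traj s (j * m)) + length (traj (shiftBy (j * m) s) m) := by
      exact_mod_cast length_mul_le _ _
    exact h1.trans (add_le_add ih le_rfl)

theorem measurable_blockLength (m j : ℕ) : Measurable (blockLength m j : Steps q → ℝ) :=
  (measurable_traj_comp m fun z => (length z : ℝ)).comp (measurable_shiftBy (j * m))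

theorem indepFun_blockLength (m : ℕ) {i j : ℕ} (hij : i < j) :
    IndepFun (blockLength m i : Steps q → ℝ) (blockLength m j) (seqLaw μ) := by
  rw [indepFun_iff_measure_inter_preimage_eq_mul]
  intro a b ha hb
  have hB : MeasurableSet (blockLength m 0 ⁻¹' b : Set (Steps q)) := measurable_blockLength m 0 hb
  have e : (blockLength m j ⁻¹' b : Set (Steps q)) =
      shiftBy (j * m) ⁻¹' (blockLength m 0 ⁻¹' b) := by
    ext s; simp [blockLength, shiftBy_shiftBy]
  rw [e, (measurePreserving_shiftBy μ (j * m)).measure_preimage hB.nullMeasurableSet,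
    seqLaw_inter_shiftBy μ (n := j * m) _ hB]
  intro s t h
  have : blockLength m i s = blockLength m i t := by
    unfold blockLength
    rw [traj_congr fun k hk => ?_]
    refine h _ ?_
    calc k + i * m < m + i * m := by omega
      _ = (i + 1) * m := by ring
      _ ≤ j * m := Nat.mul_le_mul_right m hij
  simp [this]

theorem identDistrib_blockLength (m j : ℕ) :
    IdentDistrib (blockLength m j : Steps q → ℝ) (blockLength m 0) (seqLaw μ) (seqLaw μ) := by
  refine ⟨(measurable_blockLength m j).aemeasurable, (measurable_blockLength m 0).aemeasurable, ?_⟩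
  have e : (blockLength m j : Steps q → ℝ) = blockLength m 0 ∘ shiftBy (j * m) := by
    funext s; simp [blockLength, shiftBy_shiftBy]
  rw [e, ← Measure.map_map (measurable_blockLength m 0) (measurable_shiftBy _),
    seqLaw_map_shiftBy]

theorem ae_eventually_length_lt {m : ℕ} (hm : 0 < m) {c : ℝ} (hc : meanLength μ m / m < c) :
    ∀ᵐ s ∂seqLaw μ, ∀ᶠ n : ℕ in atTop, (length (traj s n) : ℝ) < c * n := by
  have hm' : (0 : ℝ) < m := by exact_mod_cast hm
  have e0 : (blockLength m 0 : Steps q → ℝ) = fun s => (length (traj s m) : ℝ) := by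
    funext s; simp [blockLength, shiftBy_zero]
  have slln := strong_law_ae_real (μ := seqLaw μ) (blockLength m) (by
      rw [e0]; exact integrable_length m) (by
      intro i j hij
      rcases lt_or_gt_of_ne hij with h | h
      · exact indepFun_blockLength m h
      · exact (indepFun_blockLength m h).symm) (identDistrib_blockLength m)
  -- The gap `c - d` absorbs the incomplete last block, whose length is at most `m`, as soon as `(c
  -- - d) * n > m`.
  obtain ⟨d, hd1, hd2⟩ := exists_between hc
  have hd0 : 0 ≤ d := (div_nonneg (meanLength_nonneg m) hm'.le).trans hd1.le
  have hd1' : meanLength μ m < d * m := by rwa [div_lt_iff₀ hm'] at hd1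
  filter_upwards [slln] with s hs
  have h1 : (∫ s, blockLength m 0 s ∂seqLaw μ) = meanLength μ m := by rw [e0]; rfl
  rw [h1] at hs
  have h2 := hs.eventually (gt_mem_nhds hd1')
  have h3 := (Nat.tendsto_div_const_atTop hm.ne').eventually (h2.and (eventually_gt_atTop 0))
  have h4 : ∀ᶠ n : ℕ in atTop, (m : ℝ) / (c - d) < n :=
    tendsto_natCast_atTop_atTop.eventually_gt_atTop _
  filter_upwards [h3, h4] with n hn hn'
  obtain ⟨hn1, hn2⟩ := hn
  have hj : (0 : ℝ) < (n / m : ℕ) := by exact_mod_cast hn2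
  rw [div_lt_iff₀ hj] at hn1
  rw [div_lt_iff₀ (by linarith)] at hn'
  have h5 : length (traj s n) ≤ length (traj s (n / m * m)) + m := by
    conv_lhs => rw [← Nat.div_add_mod' n m, traj_add]
    refine (length_mul_le _ _).trans (Nat.add_le_add_left ?_ _)
    exact (length_traj_le _ _).trans (Nat.mod_lt n hm).le
  have h6 := length_le_sum_blockLength m s (n / m)
  have h7 : ((n / m : ℕ) : ℝ) * m ≤ n := by exact_mod_cast Nat.div_mul_le_self n m
  have h8 : (length (traj s n) : ℝ) ≤ length (traj s (n / m * m)) + m := by exact_mod_cast h5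
  nlinarith

/-! ### Almost sure lower bound by a zero-one law and a covering argument -/

/-- The paths whose length is infinitely often below a line of slope less than `c`. -/
def slowSet (q : ℕ) (c : ℝ) : Set (Steps q) :=
  {s | ∃ d : ℚ, (d : ℝ) < c ∧ ∃ᶠ n : ℕ in atTop, (length (traj s n) : ℝ) ≤ d * n}

theorem measurableSet_slowSet (c : ℝ) : MeasurableSet (slowSet q c) := by
  have : slowSet q c = ⋃ d : ℚ, ⋃ (_ : (d : ℝ) < c),
      {s | ∀ᶠ n : ℕ in atTop, ¬ (length (traj s n) : ℝ) ≤ d * n}ᶜ := by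
    ext s
    simp [slowSet, Filter.Frequently]
  rw [this]
  exact .iUnion fun d => .iUnion fun _ => (measurableSet_eventually fun n =>
    measurableSet_traj n fun z => ¬ (length z : ℝ) ≤ d * n).compl

theorem length_shift_le (s : Steps q) (n : ℕ) :
    (length (traj (shiftBy 1 s) n) : ℝ) ≤ length (traj s (n + 1)) + 1 := by
  have h1 := length_toGen_mul_le (s 0) (traj s (n + 1))
  rw [traj_succ', ← mul_assoc, toGen_mul_self, one_mul, ← traj_succ'] at h1
  exact_mod_cast h1

theorem length_le_shift (s : Steps q) (n : ℕ) :
    (length (traj s (n + 1)) : ℝ) ≤ length (traj (shiftBy 1 s) n) + 1 := by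
  rw [traj_succ']
  exact_mod_cast length_toGen_mul_le _ _

theorem frequently_atTop_add_one {φ : ℕ → Prop} :
    (∃ᶠ n in atTop, φ (n + 1)) ↔ ∃ᶠ n in atTop, φ n := by
  rw [← frequently_map (m := fun n : ℕ => n + 1) (P := φ), map_add_atTop_eq_nat]

/-- Dropping a step changes the length by at most one, which a slightly larger slope absorbs; there
is room for it because the slopes in `slowSet` are strictly below `c`. -/
theorem shiftBy_preimage_slowSet (c : ℝ) : shiftBy 1 ⁻¹' slowSet q c = slowSet q c := by
  ext s
  have aux : ∀ {d : ℚ}, (d : ℝ) < c → ∀ C : ℝ, ∃ d' : ℚ, (d' : ℝ) < c ∧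
      ∀ᶠ n : ℕ in atTop, d * (n : ℝ) + C ≤ d' * n := by
    intro d hd C
    obtain ⟨d', h1, h2⟩ := exists_rat_btwn hd
    refine ⟨d', h2, ?_⟩
    have : ∀ᶠ n : ℕ in atTop, C / (d' - d) < (n : ℝ) :=
      tendsto_natCast_atTop_atTop.eventually_gt_atTop _
    filter_upwards [this] with n hn
    rw [div_lt_iff₀ (by linarith)] at hn
    linarith
  constructor
  · rintro ⟨d, hd, h⟩
    obtain ⟨d', h1, h2⟩ := aux hd (1 - d)
    refine ⟨d', h1, frequently_atTop_add_one.1 ?_⟩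
    have h2' := (tendsto_add_atTop_nat 1).eventually h2
    refine (h.and_eventually h2').mono fun n hn => ?_
    have h3 := length_le_shift s n
    obtain ⟨h4, h5⟩ := hn
    push_cast at h5 ⊢
    linarith
  · rintro ⟨d, hd, h⟩
    obtain ⟨d', h1, h2⟩ := aux hd (1 + d)
    refine ⟨d', h1, ?_⟩
    refine ((frequently_atTop_add_one.2 h).and_eventually h2).mono fun n hn => ?_
    have h3 := length_shift_le s n
    obtain ⟨h4, h5⟩ := hn
    push_cast at h4
    linarith

/-- The paths whose length is below the line of slope `c` at some time up to `M`. -/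
def slowBy (q : ℕ) (c : ℝ) (M : ℕ) : Set (Steps q) :=
  {s | ∃ n, 1 ≤ n ∧ n ≤ M ∧ (length (traj s n) : ℝ) ≤ c * n}

theorem measurableSet_slowBy (c : ℝ) (M : ℕ) : MeasurableSet (slowBy q c M) := by
  have : slowBy q c M = ⋃ n, ⋃ (_ : 1 ≤ n), ⋃ (_ : n ≤ M),
      {s | (length (traj s n) : ℝ) ≤ c * n} := by
    ext s; simp [slowBy, and_left_comm]
  rw [this]
  exact .iUnion fun n => .iUnion fun _ => .iUnion fun _ =>
    measurableSet_traj n fun z => (length z : ℝ) ≤ c * n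

-- The time interval is covered greedily. From a time in `slowBy`, jump ahead by a stretch of at
-- most `M` steps costing at most `c` per step; from any other time, advance one step at cost one,
-- counted by the indicator. A last stretch overshooting `N` costs at most `M`.
open Classical in
theorem length_le_of_slowBy {c : ℝ} (hc : 0 ≤ c) (M N : ℕ) (s : Steps q) :
    (length (traj s N) : ℝ) ≤ c * N +
      ∑ k ∈ Finset.range N, (slowBy q c M)ᶜ.indicator (fun _ => (1 : ℝ)) (shiftBy k s) + M := by
  have hnn : ∀ t : Steps q, 0 ≤ (slowBy q c M)ᶜ.indicator (fun _ => (1 : ℝ)) t :=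
    fun t => Set.indicator_nonneg (fun _ _ => zero_le_one) t
  induction N using Nat.strong_induction_on generalizing s with
  | _ N ih =>
    cases N with
    | zero => simp [traj, length_one]
    | succ N =>
      by_cases hs : s ∈ slowBy q c M
      · obtain ⟨n, h1, h2, h3⟩ := hs
        by_cases hn : n ≤ N + 1
        · obtain ⟨r, hr⟩ := Nat.exists_eq_add_of_le hn
          have h4 := ih r (by omega) (shiftBy n s)
          have h5 : (length (traj s (N + 1)) : ℝ) ≤
              length (traj s n) + length (traj (shiftBy n s) r) := by
            rw [hr, traj_add]; exact_mod_cast length_mul_le _ _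
          rw [hr, Finset.sum_range_add]
          have h6 := Finset.sum_nonneg fun k (_ : k ∈ Finset.range n) => hnn (shiftBy k s)
          simp_rw [shiftBy_shiftBy, add_comm _ n] at h4
          rw [← hr]
          have : ((N + 1 : ℕ) : ℝ) = n + r := by rw [hr]; push_cast; ring
          rw [this]
          linarith
        · have h4 : (length (traj s (N + 1)) : ℝ) ≤ M := by
            exact_mod_cast (length_traj_le _ _).trans (by omega)
          have h6 := Finset.sum_nonneg fun k (_ : k ∈ Finset.range (N + 1)) => hnn (shiftBy k s)
          have h7 : 0 ≤ c * (N + 1 : ℕ) := by positivity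
          linarith
      · have h4 := ih N (by omega) (shiftBy 1 s)
        have h5 := length_le_shift s N
        rw [Finset.sum_range_succ']
        have h6 : (slowBy q c M)ᶜ.indicator (fun _ => (1 : ℝ)) (shiftBy 0 s) = 1 := by
          simp [shiftBy_zero, hs]
        rw [h6]
        simp_rw [shiftBy_shiftBy] at h4
        push_cast
        linarith

/-- Otherwise the event has probability one, and for large `M` almost all paths lie in `slowBy`. The
mean of the covering estimate then bounds `meanLength μ N / N` asymptotically by `c + ε`, which is
less than `speed μ`. -/
theorem seqLaw_slowSet (h : IsStepLaw p μ) {c : ℝ} (hc : c < speed μ) :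
    seqLaw μ (slowSet q c) = 0 := by
  refine (seqLaw_zero_or_one μ (measurableSet_slowSet c)
    (shiftBy_preimage_slowSet c)).resolve_right fun h1 => ?_
  have hsub : slowSet q c ⊆ ⋃ M, slowBy q c M := by
    rintro s ⟨d, hd, hs⟩
    obtain ⟨n, hn, hn1⟩ := (hs.and_eventually (eventually_ge_atTop 1)).exists
    refine Set.mem_iUnion.2 ⟨n, n, hn1, le_rfl, hn.trans ?_⟩
    gcongr
  -- Lengths are nonnegative, so a negative `c` would make `slowSet` empty.
  have hc0 : 0 ≤ c := by
    have : (slowSet q c).Nonempty := by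
      rw [Set.nonempty_iff_ne_empty]
      intro h'
      simp [h'] at h1
    obtain ⟨s, d, hd, hs⟩ := this
    obtain ⟨n, hn, hn1⟩ := (hs.and_eventually (eventually_ge_atTop 1)).exists
    have h2 : (0 : ℝ) ≤ d * n := le_trans (Nat.cast_nonneg _) hn
    have h3 : (0 : ℝ) < n := by exact_mod_cast hn1
    exact (nonneg_of_mul_nonneg_left h2 h3).trans hd.le
  have hmono : Monotone (slowBy q c) := fun M M' hM s ⟨n, h1, h2, h3⟩ => ⟨n, h1, h2.trans hM, h3⟩
  have hlim := tendsto_measure_iUnion_atTop (μ := seqLaw μ) hmono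
  have hone : seqLaw μ (⋃ M, slowBy q c M) = 1 :=
    le_antisymm prob_le_one (h1 ▸ measure_mono hsub)
  rw [hone] at hlim
  have hlim' := (ENNReal.tendsto_toReal ENNReal.one_ne_top).comp hlim
  set ε := (speed μ - c) / 2 with hε
  have hε0 : 0 < ε := by rw [hε]; linarith
  obtain ⟨M, hM⟩ := (hlim'.eventually (lt_mem_nhds
    (show 1 - ε < (1 : ENNReal).toReal by simpa using hε0))).exists
  have hM' : (seqLaw μ).real (slowBy q c M)ᶜ ≤ ε := by
    rw [probReal_compl_eq_one_sub (measurableSet_slowBy c M)]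
    change 1 - ε < (seqLaw μ).real (slowBy q c M) at hM
    linarith
  have hbound : ∀ N : ℕ, meanLength μ N ≤ c * N + N * ε + M := by
    intro N
    have hind : ∀ k, Integrable (fun s => (slowBy q c M)ᶜ.indicator (fun _ => (1 : ℝ))
        (shiftBy k s)) (seqLaw μ) := fun k =>
      (measurePreserving_shiftBy μ k).integrable_comp_of_integrable
        ((integrable_const 1).indicator (measurableSet_slowBy c M).compl)
    have hindv : ∀ k, ∫ s, (slowBy q c M)ᶜ.indicator (fun _ => (1 : ℝ)) (shiftBy k s) ∂seqLaw μ
        = (seqLaw μ).real (slowBy q c M)ᶜ := by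
      intro k
      rw [← integral_map (f := (slowBy q c M)ᶜ.indicator fun _ => (1 : ℝ))
        (measurable_shiftBy k).aemeasurable, seqLaw_map_shiftBy]
      · exact integral_indicator_one (measurableSet_slowBy c M).compl
      · exact (measurable_const.indicator (measurableSet_slowBy c M).compl).aestronglyMeasurable
    have hI := integrable_finsetSum (Finset.range N) fun k _ => hind k
    have hI' : Integrable (fun s => c * N + ∑ k ∈ Finset.range N,
        (slowBy q c M)ᶜ.indicator (fun _ => (1 : ℝ)) (shiftBy k s)) (seqLaw μ) :=
      (integrable_const _).add hI
    have h2 : meanLength μ N ≤ _ := integral_mono (integrable_length (μ := μ) N)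
      (hI'.add (integrable_const (M : ℝ))) (fun s => length_le_of_slowBy hc0 M N s)
    refine h2.trans ?_
    rw [integral_add' hI' (integrable_const _), integral_add (integrable_const _) hI,
      integral_finsetSum _ fun k _ => hind k]
    simp_rw [hindv]
    simp only [integral_const, probReal_univ, one_smul, Finset.sum_const, Finset.card_range,
      nsmul_eq_mul]
    gcongr
  have hle : speed μ ≤ c + ε := by
    have h3 : Tendsto (fun N : ℕ => c + ε + (M : ℝ) / N) atTop (𝓝 (c + ε + 0)) :=
      tendsto_const_nhds.add (tendsto_const_div_atTop_nhds_zero_nat _)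
    rw [add_zero] at h3
    refine le_of_tendsto_of_tendsto (tendsto_meanLength h) h3 ?_
    filter_upwards [eventually_gt_atTop 0] with N hN
    have hN' : (0 : ℝ) < N := by exact_mod_cast hN
    rw [div_le_iff₀ hN', add_mul, div_mul_cancel₀ _ hN'.ne']
    linarith [hbound N]
  linarith

/-- The rate of escape exists and is given by the expected limiting increment. -/
theorem ae_tendsto_length (h : IsStepLaw p μ) :
    ∀ᵐ s ∂seqLaw μ, Tendsto (fun n : ℕ => (length (traj s n) : ℝ) / n) atTop (𝓝 (speed μ)) := by
  have hup : ∀ᵐ s ∂seqLaw μ, ∀ c : ℚ, speed μ < c →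
      ∀ᶠ n : ℕ in atTop, (length (traj s n) : ℝ) < c * n := by
    rw [ae_all_iff]
    intro c
    by_cases hc : speed μ < c
    · obtain ⟨m, hm, hm'⟩ := (((tendsto_meanLength h).eventually (gt_mem_nhds hc)).and
        (eventually_gt_atTop 0)).exists
      filter_upwards [ae_eventually_length_lt hm' hm] with s hs _ using hs
    · exact ae_of_all _ fun s h' => absurd h' hc
  have hlow : ∀ᵐ s ∂seqLaw μ, ∀ c : ℚ, (c : ℝ) < speed μ → s ∉ slowSet q c := by
    rw [ae_all_iff]
    intro c
    by_cases hc : (c : ℝ) < speed μ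
    · filter_upwards [measure_eq_zero_iff_ae_notMem.1 (seqLaw_slowSet h hc)] with s hs _ using hs
    · exact ae_of_all _ fun s h' => absurd h' hc
  filter_upwards [hup, hlow] with s h1 h2
  rw [tendsto_order]
  constructor
  · intro a ha
    obtain ⟨c, hc1, hc2⟩ := exists_rat_btwn ha
    -- Two rationals `a < d < c` are needed because `slowSet q c` only refers to slopes strictly
    -- below `c`.
    obtain ⟨d, hd1, hd2⟩ := exists_rat_btwn hc1
    have h3 : ¬ ∃ᶠ n : ℕ in atTop, (length (traj s n) : ℝ) ≤ d * n :=
      fun h' => h2 c hc2 ⟨d, hd2, h'⟩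
    rw [not_frequently] at h3
    filter_upwards [h3, eventually_gt_atTop 0] with n hn hn0
    have : (0 : ℝ) < n := by exact_mod_cast hn0
    rw [lt_div_iff₀ this]
    push Not at hn
    exact lt_of_le_of_lt (by gcongr) hn
  · intro a ha
    obtain ⟨c, hc1, hc2⟩ := exists_rat_btwn ha
    filter_upwards [h1 c hc1, eventually_gt_atTop 0] with n hn hn0
    have : (0 : ℝ) < n := by exact_mod_cast hn0
    rw [div_lt_iff₀ this]
    exact lt_of_lt_of_le hn (by gcongr)

end Speed

/-! ### First visits -/

/-- The walk visits `a` for the first time at time `n`. -/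
def firstHit (a : Fin q) (n : ℕ) : Set (Steps q) :=
  {s | (traj s n).pos = gen a ∧ ∀ k < n, (traj s k).pos ≠ gen a}

theorem determinedBy_firstHit (a : Fin q) (n : ℕ) : DeterminedBy n (firstHit a n) := by
  intro s t h
  have : ∀ k ≤ n, traj s k = traj t k := fun k hk => traj_congr fun j hj => h j (by omega)
  refine and_congr (by rw [this n le_rfl]) (forall₂_congr fun k hk => ?_)
  rw [this k hk.le]

theorem pairwise_disjoint_firstHit (a : Fin q) :
    Pairwise (Function.onFun Disjoint (firstHit a)) := by
  have : ∀ m n, m < n → Disjoint (firstHit a m) (firstHit a n) := by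
    intro m n h
    rw [Set.disjoint_left]
    exact fun s hs hs' => hs'.2 m h hs.1
  intro m n h
  rcases lt_or_gt_of_ne h with h | h
  · exact this m n h
  · exact (this n m h).symm

theorem notMem_cone_of_forall_ne {a : Fin q} {s : Steps q} {n : ℕ}
    (h : ∀ k ≤ n, (traj s k).pos ≠ gen a) : (traj s n).pos ∉ cone (gen a) := by
  induction n with
  | zero => exact one_notMem_cone a
  | succ n ih =>
    have h1 := ih fun k hk => h k (by omega)
    rcases pos_succ s n with h2 | ⟨i, h2⟩
    · rwa [h2]
    · intro h3
      rw [h2] at h3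
      exact h (n + 1) le_rfl (h2.trans (eq_gen_of_enter h1 h3))

theorem lamp_eq_zero_of_forall_ne {a : Fin q} {s : Steps q} {n : ℕ}
    (h : ∀ k < n, (traj s k).pos ≠ gen a) {w : Tree q} (hw : w ∈ cone (gen a)) :
    (traj s n).lamp w = 0 := by
  rw [lamp_eq_of_forall_ne (Nat.zero_le n) fun k _ hk e => ?_]
  · rfl
  · exact notMem_cone_of_forall_ne (fun j hj => h j (by omega)) (e ▸ hw)

theorem eventually_atTop_add_iff {φ : ℕ → Prop} (n : ℕ) :
    (∀ᶠ m in atTop, φ (n + m)) ↔ ∀ᶠ m in atTop, φ m := by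
  conv_rhs => rw [← map_add_atTop_eq_nat n, eventually_map]
  simp_rw [add_comm n]

theorem Transient.not_endsIn_iff {s : Steps q} (hs : Transient s) (a : Fin q) :
    ¬ EndsIn a s ↔ ∀ᶠ n in atTop, (traj s n).pos ∉ cone (gen a) := by
  refine ⟨hs.eventually_notMem, fun h h' => ?_⟩
  obtain ⟨n, h1, h2⟩ := (h.and h').exists
  exact h1 h2

/-- After the first visit the position is `gen a` times that of the restarted walk, and this factor
exchanges the cone with its complement. -/
theorem endsIn_of_firstHit {a : Fin q} {s : Steps q} {n : ℕ} (h : s ∈ firstHit a n)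
    (ht : Transient (shiftBy n s)) : EndsIn a s ↔ ¬ EndsIn a (shiftBy n s) := by
  rw [ht.not_endsIn_iff, EndsIn, ← eventually_atTop_add_iff n]
  simp_rw [traj_add, pos_mul, h.1, gen_mul_mem_cone]

/-- Before the first visit of `a` no lamp in the cone has been touched, so the final lamps there
come from the restarted walk alone. -/
theorem lampOn_of_firstHit {a : Fin q} {s : Steps q} {n : ℕ} (h : s ∈ firstHit a n)
    {w : Tree q} (hw : w ∈ cone (gen a)) : LampOn w s ↔ LampOn (gen a * w) (shiftBy n s) := by
  rw [LampOn, ← eventually_atTop_add_iff n, LampOn]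
  simp_rw [traj_add, lamp_mul, Finsupp.add_apply, shift_apply, h.1, gen_inv,
    lamp_eq_zero_of_forall_ne h.2 hw, zero_add]

theorem not_endsIn_of_not_hit {a : Fin q} {s : Steps q} (h : s ∉ ⋃ n, firstHit a n) :
    (∀ n, (traj s n).pos ∉ cone (gen a)) ∧ ∀ w ∈ cone (gen a), ¬ LampOn w s := by
  have key : ∀ n, (traj s n).pos ≠ gen a := by
    intro n
    induction n using Nat.strong_induction_on with
    | _ n ih => exact fun hn => h (Set.mem_iUnion.2 ⟨n, hn, ih⟩)
  refine ⟨fun n => notMem_cone_of_forall_ne fun k _ => key k, fun w hw hl => ?_⟩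
  obtain ⟨n, hn⟩ := hl.exists
  rw [lamp_eq_zero_of_forall_ne (fun k _ => key k) hw] at hn
  exact absurd hn (by decide)

section Probabilities

variable (μ : Measure (Option (Fin q))) [IsProbabilityMeasure μ]

/-- The probability of ever visiting `a`. -/
def hitProb (a : Fin q) : ℝ := (seqLaw μ).real (⋃ n, firstHit a n)

variable {μ} in
/-- The strong Markov property at the first visit of `a`. -/
theorem real_eq_hitProb_mul {a : Fin q} {B B' : Set (Steps q)} (hB' : MeasurableSet B')
    (h1 : ∀ᵐ s ∂seqLaw μ, ∀ n, s ∈ firstHit a n → (s ∈ B ↔ shiftBy n s ∈ B'))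
    (h2 : ∀ᵐ s ∂seqLaw μ, s ∈ B → s ∈ ⋃ n, firstHit a n) :
    (seqLaw μ).real B = hitProb μ a * (seqLaw μ).real B' := by
  -- Splitting over the time of the first visit gives disjoint events, each an intersection of a
  -- past and a future event.
  have hae : B =ᵐ[seqLaw μ] ⋃ n, firstHit a n ∩ shiftBy n ⁻¹' B' := by
    filter_upwards [h1, h2] with s h1 h2
    refine propext ⟨fun hs => ?_, fun hs => ?_⟩
    · obtain ⟨n, hn⟩ := Set.mem_iUnion.1 (h2 hs)
      exact Set.mem_iUnion.2 ⟨n, hn, (h1 n hn).1 hs⟩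
    · obtain ⟨n, hn, hn'⟩ := Set.mem_iUnion.1 hs
      exact (h1 n hn).2 hn'
  have hm : ∀ n, MeasurableSet (firstHit a n ∩ shiftBy n ⁻¹' B') := fun n =>
    (determinedBy_firstHit a n).measurableSet.inter (measurable_shiftBy n hB')
  unfold hitProb
  rw [measureReal_congr hae, measureReal_def, measureReal_def, measureReal_def,
    ← ENNReal.toReal_mul, measure_iUnion _ hm, measure_iUnion (pairwise_disjoint_firstHit a)
      fun n => (determinedBy_firstHit a n).measurableSet, ← ENNReal.tsum_mul_right]
  · simp_rw [seqLaw_inter_shiftBy μ (determinedBy_firstHit a _) hB']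
  · intro m n h
    exact (pairwise_disjoint_firstHit a h).mono Set.inter_subset_left Set.inter_subset_left

/-! ### Equations from the first visit and from the first step -/

/-- The probability that the walk ends in `C_a`. -/
def endProb (a : Fin q) : ℝ := (seqLaw μ).real {s | EndsIn a s}

/-- The event that the walk ends outside `C_a` and a lamp inside stays on. -/
def onInside (a : Fin q) : Set (Steps q) :=
  {s | ¬ EndsIn a s ∧ ∃ w ∈ cone (gen a), LampOn w s}

/-- The event that the walk ends in `C_a` and a lamp outside stays on. -/
def onOutside (a : Fin q) : Set (Steps q) :=
  {s | EndsIn a s ∧ ∃ w ∉ cone (gen a), LampOn w s}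

/-- The event that the walk ends in `C_a` and all lamps outside are finally off. -/
def offOutside (a : Fin q) : Set (Steps q) :=
  {s | EndsIn a s ∧ ∀ w ∉ cone (gen a), ¬ LampOn w s}

theorem measurableSet_exists_lampOn (D : Set (Tree q)) :
    MeasurableSet {s : Steps q | ∃ w ∈ D, LampOn w s} := by
  have : {s : Steps q | ∃ w ∈ D, LampOn w s} = ⋃ w ∈ D, {s | LampOn w s} := by ext s; simp
  rw [this]
  exact .biUnion D.to_countable fun w _ => measurableSet_lampOn w

theorem measurableSet_onInside (a : Fin q) : MeasurableSet (onInside a) :=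
  (measurableSet_endsIn a).compl.inter (measurableSet_exists_lampOn (cone (gen a)))

theorem measurableSet_onOutside (a : Fin q) : MeasurableSet (onOutside a) :=
  (measurableSet_endsIn a).inter (measurableSet_exists_lampOn (cone (gen a))ᶜ)

variable {μ} {p : ℝ}

theorem ae_transient_shiftBy (h : IsStepLaw p μ) :
    ∀ᵐ s ∂seqLaw μ, ∀ n, Transient (shiftBy n s) := by
  rw [ae_all_iff]
  exact fun n => (measurePreserving_shiftBy μ n).quasiMeasurePreserving.ae (ae_transient h)

theorem endProb_eq (h : IsStepLaw p μ) (a : Fin q) :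
    endProb μ a = hitProb μ a * (1 - endProb μ a) := by
  unfold endProb
  rw [← probReal_compl_eq_one_sub (measurableSet_endsIn a)]
  refine real_eq_hitProb_mul (measurableSet_endsIn a).compl ?_ ?_
  · filter_upwards [ae_transient_shiftBy h] with s hs n hn
    exact endsIn_of_firstHit hn (hs n)
  · refine ae_of_all _ fun s hs => ?_
    by_contra hn
    obtain ⟨n, hn'⟩ := Eventually.exists hs
    exact (not_endsIn_of_not_hit hn).1 n hn'

/-- At the first visit of `a` the two sides of the edge exchange roles: ending outside with a lit
lamp inside becomes, for the restarted walk, ending inside with a lit lamp outside. -/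
theorem onInside_eq (h : IsStepLaw p μ) (a : Fin q) :
    (seqLaw μ).real (onInside a) = hitProb μ a * (seqLaw μ).real (onOutside a) := by
  refine real_eq_hitProb_mul (measurableSet_onOutside a) ?_ ?_
  · filter_upwards [ae_transient_shiftBy h] with s hs n hn
    refine and_congr ?_ ?_
    · rw [endsIn_of_firstHit hn (hs n), not_not]
    · constructor
      · rintro ⟨w, hw, hl⟩
        refine ⟨gen a * w, ?_, (lampOn_of_firstHit hn hw).1 hl⟩
        rw [gen_mul_mem_cone, not_not]
        exact hw
      · rintro ⟨w, hw, hl⟩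
        have hw' := gen_mul_mem_cone.2 hw
        refine ⟨gen a * w, hw', (lampOn_of_firstHit hn hw').2 ?_⟩
        rwa [gen_mul_cancel]
  · refine ae_of_all _ fun s hs => ?_
    by_contra hn
    obtain ⟨w, hw, hl⟩ := hs.2
    exact (not_endsIn_of_not_hit hn).2 w hw hl

theorem offOutside_eq_sdiff (a : Fin q) : offOutside a = {s | EndsIn a s} \ onOutside a := by
  ext s
  simp only [offOutside, onOutside, Set.mem_sdiff, Set.mem_ofPred_eq]
  push Not
  exact and_congr_right fun h1 => ⟨fun h2 _ => h2, fun h2 => h2 h1⟩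

theorem measurableSet_offOutside (a : Fin q) : MeasurableSet (offOutside a) :=
  offOutside_eq_sdiff a ▸ (measurableSet_endsIn a).diff (measurableSet_onOutside a)

theorem onOutside_eq (a : Fin q) :
    (seqLaw μ).real (onOutside a) = endProb μ a - (seqLaw μ).real (offOutside a) := by
  have hsub : onOutside a ⊆ {s | EndsIn a s} := fun s hs => hs.1
  rw [offOutside_eq_sdiff, measureReal_sdiff hsub (measurableSet_onOutside a)]
  simp [endProb]

theorem lampOn_gen_eq (a : Fin q) :
    (seqLaw μ).real {s | LampOn (gen a) s} = hitProb μ a * (seqLaw μ).real {s | LampOn 1 s} := by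
  have ha : gen a ∈ cone (gen a) := List.prefix_rfl
  refine real_eq_hitProb_mul (measurableSet_lampOn 1) ?_ ?_
  · refine ae_of_all _ fun s n hn => ?_
    have := lampOn_of_firstHit hn ha
    rwa [gen_mul_self] at this
  · refine ae_of_all _ fun s hs => ?_
    by_contra hn
    exact (not_endsIn_of_not_hit hn).2 _ ha hs

theorem lampOn_consStep_none {s : Steps q} (hs : Transient s) :
    LampOn 1 (consStep none s) ↔ ¬ LampOn 1 s := by
  have h1 : LampOn 1 (consStep none s) ↔ ∀ᶠ n in atTop, (traj s n).lamp 1 = 0 := by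
    rw [LampOn, ← eventually_atTop_add_iff 1]
    simp_rw [add_comm 1, traj_consStep, toGen, switch_mul_lamp]
    simp
  rw [h1]
  rcases hs.lamp_eventually 1 with ⟨h2, h3⟩ | ⟨h2, h3⟩
  · simp only [h2, not_true, iff_false]
    intro h4
    obtain ⟨n, h5, h6⟩ := (h3.and h4).exists
    rw [h5] at h6
    exact absurd h6 (by decide)
  · simp [h2, h3]

theorem lampOn_consStep_some (a : Fin q) (s : Steps q) :
    LampOn 1 (consStep (some a) s) ↔ LampOn (gen a) s := by
  rw [LampOn, ← eventually_atTop_add_iff 1]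
  simp_rw [add_comm 1, traj_consStep, toGen, move_mul_lamp, mul_one]
  rfl

/-- A first switch inverts the final state of the root lamp. A first move along `a` turns the root
lamp into the lamp at `a` of the remaining walk, which must visit `a` and then leave the lamp at its
new starting point on. -/
theorem lampOn_one_eq (h : IsStepLaw p μ) :
    (seqLaw μ).real {s | LampOn 1 s} = p * (1 - (seqLaw μ).real {s | LampOn 1 s}) +
      ∑ a, (1 - p) / q * (hitProb μ a * (seqLaw μ).real {s | LampOn 1 s}) := by
  conv_lhs => rw [seqLaw_real_eq_sum μ (measurableSet_lampOn 1)]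
  rw [Fintype.sum_option, h.none, ← probReal_compl_eq_one_sub (measurableSet_lampOn 1)]
  congr 1
  · congr 1
    refine measureReal_congr ?_
    filter_upwards [ae_transient h] with s hs
    exact propext (lampOn_consStep_none hs)
  · refine Finset.sum_congr rfl fun a _ => ?_
    rw [h.some, ← lampOn_gen_eq]
    congr 2
    ext s
    exact lampOn_consStep_some a s

/-! ### Symmetry under permutations of the letters -/

/-- The automorphism of the tree induced by a permutation of the letters. -/
def relabel (σ : Equiv.Perm (Fin q)) : Tree q →* Tree q :=
  Monoid.CoprodI.lift fun i =>
    Monoid.CoprodI.of (M := fun _ : Fin q => Multiplicative (ZMod 2)) (i := σ i)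

theorem relabel_gen (σ : Equiv.Perm (Fin q)) (i : Fin q) : relabel σ (gen i) = gen (σ i) :=
  Monoid.CoprodI.lift_of (M := fun _ : Fin q => Multiplicative (ZMod 2)) _ _

theorem letters_relabel (σ : Equiv.Perm (Fin q)) (x : Tree q) :
    letters (relabel σ x) = (letters x).map σ := by
  induction x using tree_induction with
  | one => simp [letters_one]
  | gen_mul i y hy ih =>
    rw [map_mul, relabel_gen, letters_gen_mul_of_ne hy, letters_gen_mul_of_ne, ih]
    · rfl
    · rw [ih]
      cases hl : letters y with
      | nil => simp
      | cons b l => simpa [hl] using hy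

theorem relabel_bijective (σ : Equiv.Perm (Fin q)) : Function.Bijective (relabel σ) := by
  constructor
  · intro x y h
    apply letters_injective
    have := congrArg letters h
    rw [letters_relabel, letters_relabel] at this
    exact List.map_injective_iff.2 σ.injective this
  · intro x
    refine ⟨relabel σ.symm x, letters_injective ?_⟩
    simp [letters_relabel]

theorem relabel_mem_cone (σ : Equiv.Perm (Fin q)) {a : Fin q} {x : Tree q} :
    relabel σ x ∈ cone (gen (σ a)) ↔ x ∈ cone (gen a) := by
  rw [mem_cone_gen, mem_cone_gen, letters_relabel, List.head?_map]
  cases (letters x).head? <;> simp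

/-- The action of a permutation of the letters on sequences of steps. -/
def relabelSteps (σ : Equiv.Perm (Fin q)) (s : Steps q) : Steps q := fun n => (s n).map σ

theorem traj_relabelSteps (σ : Equiv.Perm (Fin q)) (s : Steps q) (n : ℕ) :
    (traj (relabelSteps σ s) n).pos = relabel σ (traj s n).pos ∧
      ∀ w, (traj (relabelSteps σ s) n).lamp (relabel σ w) = (traj s n).lamp w := by
  induction n with
  | zero => simp [traj, pos_one, lamp_one]
  | succ n ih =>
    have e : relabelSteps σ s n = (s n).map σ := rfl
    simp only [traj, pos_mul, lamp_mul, Finsupp.add_apply, shift_apply, ih.1, ih.2, e, map_mul]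
    constructor
    · cases s n with
      | none => simp [toGen, switchGen]
      | some i => simp [toGen, moveGen, relabel_gen]
    · intro w
      rw [← map_inv, ← map_mul]
      congr 1
      cases s n with
      | none =>
        have := (relabel_bijective σ).1.eq_iff (a := 1) (b := (traj s n).pos⁻¹ * w)
        rw [map_one] at this
        simp [toGen, switchGen, Finsupp.single_apply, -map_mul, this]
      | some i => simp [toGen, moveGen]

theorem map_option_map_eq (h : IsStepLaw p μ) (σ : Equiv.Perm (Fin q)) :
    μ.map (Option.map σ) = μ := by
  refine Measure.ext_of_singleton fun x => ?_
  rw [Measure.map_apply (measurable_of_countable _) (measurableSet_singleton x)]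
  rw [← ENNReal.toReal_eq_toReal_iff' (measure_ne_top _ _) (measure_ne_top _ _)]
  change μ.real _ = μ.real _
  cases x with
  | none =>
    congr 1
    ext y; simp
  | some i =>
    have : Option.map σ ⁻¹' {some i} = {some (σ.symm i)} := by
      ext y
      cases y <;> simp [Equiv.eq_symm_apply]
    rw [this, h.some, h.some]

theorem seqLaw_map_relabelSteps (h : IsStepLaw p μ) (σ : Equiv.Perm (Fin q)) :
    (seqLaw μ).map (relabelSteps σ) = seqLaw μ := by
  have h1 := Measure.infinitePi_map_pi (μ := fun _ : ℕ => μ)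
    (f := fun _ : ℕ => Option.map σ) fun _ => measurable_of_countable _
  simp only [map_option_map_eq h σ] at h1
  exact h1

theorem real_eq_of_relabel (h : IsStepLaw p μ) {E : Fin q → Set (Steps q)}
    (hE : ∀ a, MeasurableSet (E a))
    (hσ : ∀ (σ : Equiv.Perm (Fin q)) a s, relabelSteps σ s ∈ E (σ a) ↔ s ∈ E a) (a b : Fin q) :
    (seqLaw μ).real (E a) = (seqLaw μ).real (E b) := by
  -- The transposition of `a` and `b` is enough.
  have hm : Measurable (relabelSteps (Equiv.swap a b)) :=
    measurable_pi_lambda _ fun n => (measurable_of_countable _).comp (measurable_pi_apply n)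
  rw [← seqLaw_map_relabelSteps h (Equiv.swap a b), map_measureReal_apply hm (hE b),
    seqLaw_map_relabelSteps h]
  congr 1
  ext s
  have := hσ (Equiv.swap a b) a s
  rw [Equiv.swap_apply_left] at this
  exact this.symm

theorem endsIn_relabelSteps (σ : Equiv.Perm (Fin q)) (a : Fin q) (s : Steps q) :
    EndsIn (σ a) (relabelSteps σ s) ↔ EndsIn a s := by
  simp only [EndsIn, (traj_relabelSteps σ s _).1, relabel_mem_cone]

theorem lampOn_relabelSteps (σ : Equiv.Perm (Fin q)) (w : Tree q) (s : Steps q) :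
    LampOn (relabel σ w) (relabelSteps σ s) ↔ LampOn w s := by
  simp only [LampOn, (traj_relabelSteps σ s _).2]

/-- A transient walk ends in exactly one of the `q` cones, and these are equally likely. -/
theorem endProb_eq_inv (h : IsStepLaw p μ) (a : Fin q) : endProb μ a = 1 / q := by
  have hq : (0 : ℝ) < q := by exact_mod_cast (by have := h.three_le; omega : 0 < q)
  have h1 : ∀ b, endProb μ b = endProb μ a := fun b =>
    real_eq_of_relabel h (E := fun a => {s | EndsIn a s}) measurableSet_endsIn
      endsIn_relabelSteps b a
  have h2 : ∑ b, endProb μ b = 1 := by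
    unfold endProb
    rw [← measureReal_biUnion_finset]
    · rw [measureReal_congr (t := Set.univ), probReal_univ]
      filter_upwards [ae_transient h] with s hs
      refine propext ⟨fun _ => trivial, fun _ => ?_⟩
      obtain ⟨b, hb⟩ := hs.exists_endsIn
      exact Set.mem_biUnion (Finset.mem_univ b) hb
    · intro b _ c _ hbc
      exact Set.disjoint_left.2 fun s h1 h2 => hbc (EndsIn.unique h1 h2)
    · exact fun b _ => measurableSet_endsIn b
  simp only [h1, Finset.sum_const, Finset.card_univ, Fintype.card_fin, nsmul_eq_mul] at h2
  field_simp
  linarith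

theorem hitProb_eq (h : IsStepLaw p μ) (a : Fin q) : hitProb μ a = 1 / (q - 1) := by
  have hq : (3 : ℝ) ≤ q := by exact_mod_cast h.three_le
  have h1 := endProb_eq h a
  rw [endProb_eq_inv h] at h1
  have : (q : ℝ) - 1 ≠ 0 := by linarith
  field_simp at h1 ⊢
  linarith

theorem onInside_const (h : IsStepLaw p μ) (a b : Fin q) :
    (seqLaw μ).real (onInside a) = (seqLaw μ).real (onInside b) := by
  refine real_eq_of_relabel h measurableSet_onInside (fun σ a s => ?_) a b
  refine and_congr (not_congr (endsIn_relabelSteps σ a s)) ?_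
  rw [(relabel_bijective σ).2.exists]
  simp_rw [relabel_mem_cone, lampOn_relabelSteps]

theorem lampOn_one_prob (h : IsStepLaw p μ) :
    (seqLaw μ).real {s | LampOn 1 s} = p * (q - 1) / (p * q + q - 2) := by
  have hq : (3 : ℝ) ≤ q := by exact_mod_cast h.three_le
  have hp := h.pos
  have h1 := lampOn_one_eq h
  simp only [hitProb_eq h, Finset.sum_const, Finset.card_univ, Fintype.card_fin,
    nsmul_eq_mul] at h1
  have h2 : (q : ℝ) - 1 ≠ 0 := by linarith
  have h3 : p * q + q - 2 ≠ 0 := by nlinarith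
  generalize (seqLaw μ).real {s | LampOn 1 s} = r at h1
  rw [eq_div_iff h3]
  field_simp at h1
  linarith

/-! ### Evaluation of the speed -/

theorem onInside_prob (h : IsStepLaw p μ) (a : Fin q) : (seqLaw μ).real (onInside a) =
    1 / (q - 1) * (1 / q - (seqLaw μ).real (offOutside a)) := by
  rw [onInside_eq h, onOutside_eq, hitProb_eq h, endProb_eq_inv h]

theorem integral_ite_one_neg_one {φ : Steps q → Prop} [DecidablePred φ]
    (hφ : MeasurableSet {s | φ s}) :
    ∫ s, (if φ s then (1 : ℝ) else -1) ∂seqLaw μ = 2 * (seqLaw μ).real {s | φ s} - 1 := by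
  have : ∀ s, (if φ s then (1 : ℝ) else -1) = 2 * {s | φ s}.indicator (fun _ => (1 : ℝ)) s - 1 := by
    intro s
    by_cases h : φ s
    · simp [h]; norm_num
    · simp [h]
  simp_rw [this]
  rw [integral_sub (((integrable_const (1 : ℝ)).indicator hφ).const_mul 2) (integrable_const 1),
    integral_const_mul, integral_indicator hφ]
  simp

theorem integral_changeLim_none : ∫ s, changeLim none s ∂seqLaw μ =
    1 - 2 * (seqLaw μ).real {s | LampOn 1 s} := by
  classical
  have : ∀ s : Steps q, changeLim none s = -(if LampOn 1 s then (1 : ℝ) else -1) := by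
    intro s
    by_cases h : LampOn 1 s <;> simp [changeLim, h]
  simp_rw [this]
  rw [integral_neg, integral_ite_one_neg_one (measurableSet_lampOn 1)]
  ring

/-- The complement consists of the disjoint events `onInside a` and `offOutside a`, whose
probabilities become `ν₁` and `ν₂`. -/
theorem real_moveUpLim (a : Fin q) : (seqLaw μ).real {s | MoveUpLim a s} =
    1 - (seqLaw μ).real (onInside a) - (seqLaw μ).real (offOutside a) := by
  have e : {s | MoveUpLim a s} = onOutside a ∪ ({s | EndsIn a s}ᶜ \ onInside a) := by
    ext s
    simp only [MoveUpLim, onOutside, onInside, Set.mem_union, Set.mem_sdiff, Set.mem_ofPred_eq,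
      Set.mem_compl_iff]
    refine or_congr Iff.rfl (and_congr_right fun h1 => ?_)
    push Not
    exact ⟨fun h2 _ => h2, fun h2 => h2 h1⟩
  have hsub : onInside a ⊆ {s | EndsIn a s}ᶜ := fun s hs => hs.1
  rw [e, measureReal_union _ ((measurableSet_endsIn a).compl.diff (measurableSet_onInside a)),
    measureReal_sdiff hsub (measurableSet_onInside a),
    probReal_compl_eq_one_sub (measurableSet_endsIn a), onOutside_eq]
  · change _ - _ + (1 - endProb μ a - _) = _
    ring
  · exact Set.disjoint_left.2 fun s h1 h2 => h2.1 h1.1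

theorem integral_changeLim_some (a : Fin q) :
    ∫ s, changeLim (some a) s ∂seqLaw μ =
      1 - 2 * (seqLaw μ).real (onInside a) - 2 * (seqLaw μ).real (offOutside a) := by
  classical
  have hm : MeasurableSet {s | MoveUpLim a s} := by
    have e : {s : Steps q | ∀ w ∈ cone (gen a), ¬ LampOn w s} =
        {s | ∃ w ∈ cone (gen a), LampOn w s}ᶜ := by ext s; simp
    refine (measurableSet_onOutside a).union ((measurableSet_endsIn a).compl.inter
      (s₂ := {s | ∀ w ∈ cone (gen a), ¬ LampOn w s}) ?_)
    exact e ▸ (measurableSet_exists_lampOn (cone (gen a))).compl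
  have := integral_ite_one_neg_one (μ := μ) hm
  rw [real_moveUpLim] at this
  convert this using 1
  · simp [changeLim]
  · ring

/-- The formulas for the rate of escape. -/
theorem speed_eq (h : IsStepLaw p μ) (a : Fin q) :
    speed μ = (1 - p) * (q - 2) / q *
        (1 + 2 * q * (seqLaw μ).real (onInside a) + p * q / (p * q + q - 2)) ∧
      speed μ = (1 - p) * (q - 2) / q *
        ((q + 1) / (q - 1) - 2 * q / (q - 1) * (seqLaw μ).real (offOutside a)
          + p * q / (p * q + q - 2)) := by
  have hq : (3 : ℝ) ≤ q := by exact_mod_cast h.three_le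
  have hp := h.pos
  have h2 : (q : ℝ) - 1 ≠ 0 := by linarith
  have h3 : p * q + q - 2 ≠ 0 := by nlinarith
  have h4 : (q : ℝ) ≠ 0 := by linarith
  -- Eliminates `ν₂` by the first-visit relation; by symmetry one unknown, taken at `a`, serves
  -- every letter `b`.
  have off : ∀ b, (seqLaw μ).real (offOutside b) =
      1 / q - (q - 1) * (seqLaw μ).real (onInside a) := by
    intro b
    rw [onInside_const h a b, onInside_prob h b]
    field_simp
    ring
  have hs : speed μ = p * (1 - 2 * (p * (q - 1) / (p * q + q - 2))) +
      (1 - p) * (1 - 2 * (seqLaw μ).real (onInside a) -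
        2 * (1 / q - (q - 1) * (seqLaw μ).real (onInside a))) := by
    unfold speed
    rw [Fintype.sum_option, h.none, integral_changeLim_none, lampOn_one_prob h]
    congr 1
    simp_rw [h.some, integral_changeLim_some, off, fun b => onInside_const h b a]
    simp only [Finset.sum_const, Finset.card_univ, Fintype.card_fin, nsmul_eq_mul]
    field_simp
  have h5 : q * (p + 1) - 2 ≠ 0 := by convert h3 using 1; ring
  rw [hs, off a]
  generalize (seqLaw μ).real (onInside a) = ν
  constructor
  · field_simp
    ring
  · field_simp
    ring

end Probabilities

/-! ### The limiting end -/

/-- The `n`-th letter of the position is finally `i`. -/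
def LetterIs (n : ℕ) (i : Fin q) (s : Steps q) : Prop :=
  ∀ᶠ m in atTop, (letters (traj s m).pos)[n]? = some i

open Classical in
/-- The `n`-th letter of the limiting end, with default value `d`. -/
def limLetter (d : Fin q) (s : Steps q) (n : ℕ) : Fin q :=
  if h : ∃ i, LetterIs n i s then h.choose else d

theorem limLetter_eq {d : Fin q} {s : Steps q} {n : ℕ} {i : Fin q}
    (h : LetterIs n i s) : limLetter d s n = i := by
  have h' : ∃ i, LetterIs n i s := ⟨i, h⟩
  rw [limLetter, dif_pos h']
  obtain ⟨m, h1, h2⟩ := (h'.choose_spec.and h).exists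
  rw [h1] at h2
  exact Option.some_injective _ h2

theorem Transient.limLetter_spec {s : Steps q} (hs : Transient s) (d : Fin q) (n : ℕ) :
    LetterIs n (limLetter d s n) s := by
  obtain ⟨l, h1, h2⟩ := hs.take_eventually (n + 1)
  have h3 : LetterIs n (l[n]'(by omega)) s := by
    filter_upwards [h2] with m hm
    rw [← List.getElem?_eq_getElem, ← hm, List.getElem?_take_of_lt (Nat.lt_succ_self n)]
  rwa [limLetter_eq h3]

/-- Each fibre is the event of convergence to that letter, together with the event of no convergence
when the letter is the default `d`. -/
theorem measurable_limLetter (d : Fin q) (n : ℕ) : Measurable fun s => limLetter d s n := by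
  have hm : ∀ i : Fin q, MeasurableSet {s | LetterIs n i s} := fun i =>
    measurableSet_eventually fun m => measurableSet_traj m fun z => (letters z.pos)[n]? = some i
  refine measurable_to_countable' fun i => ?_
  have : (fun s => limLetter d s n) ⁻¹' {i} = {s | LetterIs n i s} ∪
      if d = i then (⋃ j, {s | LetterIs n j s})ᶜ else ∅ := by
    ext s
    by_cases h : ∃ j, LetterIs n j s
    · obtain ⟨j, hj⟩ := h
      have h1 := limLetter_eq (d := d) hj
      have h2 : LetterIs n i s ↔ j = i :=
        ⟨fun h => h1.symm.trans (limLetter_eq h), fun h => h ▸ hj⟩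
      have h3 : ¬ ∀ j, ¬ LetterIs n j s := fun h => h j hj
      split_ifs <;> simp [h1, h2, h3]
    · have h1 : limLetter d s n = d := by rw [limLetter, dif_neg h]
      have h2 : ∀ j, ¬ LetterIs n j s := fun j hj => h ⟨j, hj⟩
      split_ifs with h3
      · simp [← h3, h1, h2]
      · simp [h1, h2, h3]
  rw [this]
  refine (hm i).union ?_
  split_ifs
  · exact (MeasurableSet.iUnion hm).compl
  · exact .empty

theorem Transient.limLetter_ne {s : Steps q} (hs : Transient s) (d : Fin q) (n : ℕ) :
    limLetter d s n ≠ limLetter d s (n + 1) := by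
  obtain ⟨m, h1, h2⟩ := ((hs.limLetter_spec d n).and (hs.limLetter_spec d (n + 1))).exists
  obtain ⟨h3, h4⟩ := List.getElem?_eq_some_iff.1 h1
  obtain ⟨h5, h6⟩ := List.getElem?_eq_some_iff.1 h2
  rw [← h4, ← h6]
  exact List.isChain_iff_getElem.1 (letters_chain _) n (by omega)

theorem Transient.take_eq_limLetter {s : Steps q} (hs : Transient s) (d : Fin q) (k : ℕ) :
    ∀ᶠ m in atTop, (letters (traj s m).pos).take k = (List.range k).map (limLetter d s) := by
  have : ∀ᶠ m in atTop, ∀ n ∈ Finset.range k,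
      (letters (traj s m).pos)[n]? = some (limLetter d s n) :=
    (Finset.eventually_all _).2 fun n _ => hs.limLetter_spec d n
  filter_upwards [this] with m hm
  refine List.ext_getElem? fun n => ?_
  by_cases hn : n < k
  · rw [List.getElem?_take_of_lt hn, hm n (Finset.mem_range.2 hn)]
    simp [hn]
  · simp [hn]

open Classical in
/-- The limiting end of a transient walk. -/
def limEnd (e : TreeEnd q) (s : Steps q) : TreeEnd q :=
  if h : ∀ n, limLetter (e.1 0) s n ≠ limLetter (e.1 0) s (n + 1) then ⟨limLetter (e.1 0) s, h⟩
  else e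

theorem limEnd_val {e : TreeEnd q} {s : Steps q}
    (h : ∀ n, limLetter (e.1 0) s n ≠ limLetter (e.1 0) s (n + 1)) :
    (limEnd e s).1 = limLetter (e.1 0) s :=
  congrArg Subtype.val (dif_pos h : limEnd e s = ⟨limLetter (e.1 0) s, h⟩)

theorem limEnd_default {e : TreeEnd q} {s : Steps q}
    (h : ¬ ∀ n, limLetter (e.1 0) s n ≠ limLetter (e.1 0) s (n + 1)) : limEnd e s = e :=
  dif_neg h

theorem measurable_limEnd (e : TreeEnd q) : Measurable (limEnd e) := by
  classical
  have h1 : MeasurableSet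
      {s | ∀ n, limLetter (e.1 0) s n ≠ limLetter (e.1 0) s (n + 1)} := by
    rw [Set.ofPred_forall]
    exact .iInter fun n => (measurableSet_eq_fun (measurable_limLetter _ n)
      (measurable_limLetter _ (n + 1))).compl
  have h2 : Measurable fun s => (limEnd e s).1 := by
    refine measurable_pi_lambda _ fun n => ?_
    have : (fun s => (limEnd e s).1 n) = fun s =>
        if ∀ n, limLetter (e.1 0) s n ≠ limLetter (e.1 0) s (n + 1) then limLetter (e.1 0) s n
        else e.1 n := by
      funext s
      split_ifs with h
      · rw [limEnd_val h]
      · rw [limEnd_default h]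
    rw [this]
    exact Measurable.ite h1 (measurable_limLetter _ n) measurable_const
  exact h2.subtype_mk

theorem Transient.tendsto_limEnd {s : Steps q} (hs : Transient s) (e : TreeEnd q) :
    Tendsto (fun n => TreeHat.vertex (traj s n).pos) atTop
      (𝓝 (TreeHat.boundary (limEnd e s))) := by
  have hl : (limEnd e s).1 = limLetter (e.1 0) s :=
    limEnd_val fun n => hs.limLetter_ne (e.1 0) n
  rw [TopologicalSpace.tendsto_nhds_generateFrom_iff]
  rintro U (⟨x, rfl⟩ | ⟨w, rfl⟩) hU
  -- A vertex singleton contains no boundary point, so only completed cones matter.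
  · simp at hU
  · rcases hU with ⟨x, -, hx⟩ | ⟨ξ, hξ, hξ'⟩
    · cases hx
    · obtain rfl : ξ = limEnd e s := by injection hξ'
      have h1 : (List.range (letters w).length).map (limEnd e s).1 = letters w := hξ
      rw [hl] at h1
      filter_upwards [hs.take_eq_limLetter (e.1 0) (letters w).length] with m hm
      refine Or.inl ⟨_, ?_, rfl⟩
      change letters w <+: _
      rw [← h1, ← hm]
      exact List.take_prefix _ _

theorem endsIn_of_tendsto {s : Steps q} {ξ : TreeEnd q}
    (h : Tendsto (fun n => TreeHat.vertex (traj s n).pos) atTop (𝓝 (TreeHat.boundary ξ)))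
    (a : Fin q) : ξ.1 0 = a ↔ EndsIn a s := by
  have h1 : EndsIn (ξ.1 0) s := by
    have hopen : IsOpen (coneHat (gen (ξ.1 0))) :=
      TopologicalSpace.isOpen_generateFrom_of_mem (Or.inr ⟨_, rfl⟩)
    have hmem : TreeHat.boundary ξ ∈ coneHat (gen (ξ.1 0)) := by
      refine Or.inr ⟨ξ, ?_, rfl⟩
      simp [coneBoundary, letters_gen]
    filter_upwards [h.eventually (hopen.mem_nhds hmem)] with n hn
    rcases hn with ⟨x, hx, hx'⟩ | ⟨x, -, hx'⟩
    · injection hx' with hx'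
      rwa [← hx']
    · cases hx'
  exact ⟨fun h2 => h2 ▸ h1, fun h2 => h1.unique h2⟩

theorem Transient.lampOn_iff_of_tendsto {s : Steps q} (hs : Transient s) {w : Tree q} {c : ZMod 2}
    (h : Tendsto (fun n => (traj s n).lamp w) atTop (𝓝 c)) : LampOn w s ↔ c ≠ 0 := by
  rw [nhds_discrete, tendsto_pure] at h
  rcases hs.lamp_eventually w with ⟨h1, h2⟩ | ⟨h1, h2⟩
  · obtain ⟨n, h3, h4⟩ := (h.and h2).exists
    rw [h3] at h4
    simp [h1, h4]
  · obtain ⟨n, h3, h4⟩ := (h.and h2).exists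
    rw [h3] at h4
    simp [h1, h4]

/-! ### From increments to steps -/

open Classical in
/-- The step belonging to an increment. -/
def stepOf (g : Lamplighter q) : Option (Fin q) :=
  if h : ∃ i, g = moveGen i then some h.choose else none

theorem moveGen_injective : Function.Injective (moveGen : Fin q → Lamplighter q) := by
  intro i j h
  have := congrArg (fun z => letters (Lamplighter.pos z)) h
  simpa [moveGen, letters_gen] using this

theorem stepOf_eq_some {g : Lamplighter q} {i : Fin q} : stepOf g = some i ↔ g = moveGen i := by
  unfold stepOf
  split_ifs with h
  · constructor
    · intro h'
      rw [← Option.some_injective _ h']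
      exact h.choose_spec
    · intro h'
      rw [moveGen_injective (h.choose_spec.symm.trans h')]
  · constructor
    · intro h'; cases h'
    · intro h'; exact absurd ⟨i, h'⟩ h

theorem switchGen_ne_moveGen (i : Fin q) : switchGen q ≠ moveGen i := by
  intro h
  have := congrArg (fun z => Lamplighter.lamp z 1) h
  simp [switchGen, moveGen] at this

theorem stepOf_switchGen : stepOf (switchGen q) = none := by
  cases h : stepOf (switchGen q) with
  | none => rfl
  | some i => exact absurd (stepOf_eq_some.1 h) (switchGen_ne_moveGen i)

/-- The sequence of steps of a sequence of increments. -/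
def stepSeq {Ω : Type*} (inc : ℕ → Ω → Lamplighter q) (ω : Ω) : Steps q := fun k => stepOf (inc k ω)

theorem walk_eq_traj {Ω : Type*} {inc : ℕ → Ω → Lamplighter q} {ω : Ω} (h : ∀ k, toGen (stepOf (inc k ω)) = inc k ω) (n : ℕ) :
    walk inc n ω = traj (stepSeq inc ω) n := by
  induction n with
  | zero => rfl
  | succ n ih => rw [walk, traj, ih, stepSeq, h]

section Transfer

variable {Ω : Type*} [MeasurableSpace Ω] {P : Measure Ω} {p : ℝ}
  {inc : ℕ → Ω → Lamplighter q}

theorem measurable_stepOf_inc (hmeas : ∀ k, Measurable (inc k)) (k : ℕ) :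
    Measurable fun ω => stepOf (inc k ω) :=
  (measurable_from_top (f := stepOf)).comp (hmeas k)

theorem measurable_stepSeq (hmeas : ∀ k, Measurable (inc k)) : Measurable (stepSeq inc) :=
  measurable_pi_lambda _ (measurable_stepOf_inc hmeas)

theorem real_stepOf_some (hlaw : ∀ k w, P.real {ω | inc k ω = w} = stepProb q p w) (k : ℕ)
    (i : Fin q) : P.real {ω | stepOf (inc k ω) = some i} = (1 - p) / q := by
  simp_rw [stepOf_eq_some]
  rw [hlaw, stepProb, if_neg (switchGen_ne_moveGen i).symm, if_pos ⟨i, rfl⟩]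

/-- `stepOf` sends everything that is not a move to `none`, and the `q` moves together have mass `1
- p`. -/
theorem real_stepOf_none [IsProbabilityMeasure P] (hq : 0 < q) (hmeas : ∀ k, Measurable (inc k))
    (hlaw : ∀ k w, P.real {ω | inc k ω = w} = stepProb q p w) (k : ℕ) :
    P.real {ω | stepOf (inc k ω) = none} = p := by
  have hm := measurable_stepOf_inc hmeas k
  have h1 : IsProbabilityMeasure (P.map fun ω => stepOf (inc k ω)) :=
    Measure.isProbabilityMeasure_map hm.aemeasurable
  have h2 := sum_measureReal_singleton (μ := P.map fun ω => stepOf (inc k ω)) Finset.univ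
  simp only [Finset.coe_univ, probReal_univ, Fintype.sum_option,
    map_measureReal_apply hm (measurableSet_singleton _)] at h2
  have h3 := fun i => real_stepOf_some hlaw k i
  simp only [Set.preimage, Set.mem_singleton_iff, h3, Finset.sum_const, Finset.card_univ,
    Fintype.card_fin, nsmul_eq_mul] at h2
  have : (q : ℝ) ≠ 0 := by exact_mod_cast hq.ne'
  rw [mul_div_cancel₀ _ this] at h2
  linarith

/-- The event of no move contains the event of a switch and has the same probability `p`, so
increments outside the generating set have probability zero. -/
theorem ae_toGen_stepOf [IsProbabilityMeasure P] (hq : 0 < q) (hmeas : ∀ k, Measurable (inc k))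
    (hlaw : ∀ k w, P.real {ω | inc k ω = w} = stepProb q p w) :
    ∀ᵐ ω ∂P, ∀ k, toGen (stepOf (inc k ω)) = inc k ω := by
  rw [ae_all_iff]
  intro k
  have h1 : P.real ({ω | stepOf (inc k ω) = none} \ {ω | inc k ω = switchGen q}) = 0 := by
    rw [measureReal_sdiff, real_stepOf_none hq hmeas hlaw, hlaw, stepProb, if_pos rfl, sub_self]
    · intro ω hω
      rw [Set.mem_ofPred_eq] at hω ⊢
      rw [hω, stepOf_switchGen]
    · exact hmeas k (t := {switchGen q}) MeasurableSpace.measurableSet_top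
  rw [measureReal_eq_zero_iff] at h1
  filter_upwards [measure_eq_zero_iff_ae_notMem.1 h1] with ω hω
  cases h : stepOf (inc k ω) with
  | none =>
    by_contra h'
    exact hω ⟨h, fun h'' => h' h''.symm⟩
  | some i => exact (stepOf_eq_some.1 h).symm

theorem map_stepSeq [IsProbabilityMeasure P] (hq : 0 < q) (hmeas : ∀ k, Measurable (inc k)) (hindep : iIndepFun inc P)
    (hlaw : ∀ k w, P.real {ω | inc k ω = w} = stepProb q p w) (μ : Measure (Option (Fin q)))
    [IsProbabilityMeasure μ] (hμ : μ = P.map fun ω => stepOf (inc 0 ω)) :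
    P.map (stepSeq inc) = seqLaw μ := by
  have h1 := (hindep.comp (fun _ => stepOf) fun _ => measurable_from_top).map_fun_eq_infinitePi_map
    (measurable_stepOf_inc hmeas)
  refine h1.trans ?_
  unfold seqLaw
  congr 1
  funext k
  rw [hμ]
  have hp : ∀ k, IsProbabilityMeasure (P.map (stepOf ∘ inc k)) := fun k =>
    Measure.isProbabilityMeasure_map (measurable_stepOf_inc hmeas k).aemeasurable
  have h2 := hp k
  have h3 : IsProbabilityMeasure (P.map fun ω => stepOf (inc 0 ω)) := hp 0
  refine Measure.ext_of_singleton fun x => ?_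
  rw [← ENNReal.toReal_eq_toReal_iff' (measure_ne_top _ _) (measure_ne_top _ _)]
  change (P.map _).real _ = (P.map _).real _
  rw [map_measureReal_apply (measurable_stepOf_inc hmeas k) (measurableSet_singleton x),
    map_measureReal_apply (measurable_stepOf_inc hmeas 0) (measurableSet_singleton x)]
  cases x with
  | none => exact (real_stepOf_none hq hmeas hlaw k).trans (real_stepOf_none hq hmeas hlaw 0).symm
  | some i => exact (real_stepOf_some hlaw k i).trans (real_stepOf_some hlaw 0 i).symm

end Transfer

end LampTree

end

/-! ### Transfer to the given increments -/

theorem mainTheorem1 (q : ℕ) (hq : 3 ≤ q) (p : ℝ) (hp0 : 0 < p) (hp1 : p < 1)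
    {Ω : Type*} [MeasurableSpace Ω] (P : Measure Ω) [IsProbabilityMeasure P]
    (inc : ℕ → Ω → LampTree.Lamplighter q)
    (hmeas : ∀ k, Measurable (inc k))
    (hindep : iIndepFun inc P)
    (hlaw : ∀ k w, P.real {ω | inc k ω = w} = LampTree.stepProb q p w) :
    (∃ X : Ω → LampTree.TreeEnd q, Measurable X ∧ LampTree.IsLimitEnd P inc X) ∧
    (∃ η : Ω → LampTree.Tree q → ZMod 2, Measurable η ∧ LampTree.IsLimitLamps P inc η) ∧
    ∃ l : ℝ,
      (∀ᵐ ω ∂P, Tendsto (fun n : ℕ => (LampTree.length (LampTree.walk inc n ω) : ℝ) / n)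
        atTop (𝓝 l)) ∧
      ∀ (X : Ω → LampTree.TreeEnd q) (η : Ω → LampTree.Tree q → ZMod 2),
        LampTree.IsLimitEnd P inc X → LampTree.IsLimitLamps P inc η →
        ∀ a : Fin q,
          l = (1 - p) * (q - 2) / q *
            (1 + 2 * q * LampTree.nu1 P X η a + p * q / (p * q + q - 2)) ∧
          l = (1 - p) * (q - 2) / q *
            ((q + 1) / (q - 1) - 2 * q / (q - 1) * LampTree.nu2 P X η a
              + p * q / (p * q + q - 2)) := by
  classical
  have hq0 : 0 < q := by omega
  have hS := LampTree.measurable_stepSeq hmeas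
  obtain ⟨μ, hμ⟩ : ∃ μ, μ = P.map fun ω => LampTree.stepOf (inc 0 ω) := ⟨_, rfl⟩
  have hm0 := LampTree.measurable_stepOf_inc hmeas 0
  have hprob : IsProbabilityMeasure μ :=
    hμ ▸ Measure.isProbabilityMeasure_map hm0.aemeasurable
  have hstep : LampTree.IsStepLaw p μ :=
    { three_le := hq
      pos := hp0
      lt_one := hp1
      none := by
        rw [hμ, map_measureReal_apply hm0 (measurableSet_singleton _)]
        exact LampTree.real_stepOf_none hq0 hmeas hlaw 0
      some := fun i => by
        rw [hμ, map_measureReal_apply hm0 (measurableSet_singleton _)]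
        exact LampTree.real_stepOf_some hlaw 0 i }
  have hmap := LampTree.map_stepSeq hq0 hmeas hindep hlaw μ hμ
  -- The step sequence has law `seqLaw μ`, so almost sure statements about the canonical walk hold
  -- along `stepSeq inc`.
  have pull : ∀ {φ : LampTree.Steps q → Prop}, (∀ᵐ s ∂LampTree.seqLaw μ, φ s) →
      ∀ᵐ ω ∂P, φ (LampTree.stepSeq inc ω) := fun h =>
    ae_of_ae_map hS.aemeasurable (hmap ▸ h)
  have htrans := pull (LampTree.ae_transient hstep)
  have hwalk : ∀ᵐ ω ∂P, ∀ n, LampTree.walk inc n ω = LampTree.traj (LampTree.stepSeq inc ω) n := by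
    filter_upwards [LampTree.ae_toGen_stepOf hq0 hmeas hlaw] with ω hω
    exact LampTree.walk_eq_traj hω
  refine ⟨?_, ?_, LampTree.speed μ, ?_, ?_⟩
  -- An arbitrary alternating end, the value of the limit on exceptional paths; its first letter is
  -- also the default letter in `limLetter`.
  · let e : LampTree.TreeEnd q :=
      ⟨fun n => if Even n then ⟨0, hq0⟩ else ⟨1, by omega⟩, fun n => by
        by_cases h : Even n <;> simp [h, Nat.even_add_one]⟩
    refine ⟨fun ω => LampTree.limEnd e (LampTree.stepSeq inc ω),
      (LampTree.measurable_limEnd e).comp hS, ?_⟩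
    filter_upwards [htrans, hwalk] with ω h1 h2
    simp_rw [h2]
    exact h1.tendsto_limEnd e
  · refine ⟨fun ω w => if LampTree.LampOn w (LampTree.stepSeq inc ω) then 1 else 0,
      measurable_pi_lambda _ fun w => Measurable.ite (hS (LampTree.measurableSet_lampOn w))
        measurable_const measurable_const, ?_⟩
    filter_upwards [htrans, hwalk] with ω h1 h2 w
    simp_rw [h2]
    refine tendsto_const_nhds.congr' ?_
    rcases h1.lamp_eventually w with ⟨h3, h4⟩ | ⟨h3, h4⟩
    · filter_upwards [h4] with n hn
      rw [hn, if_pos h3]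
    · filter_upwards [h4] with n hn
      rw [hn, if_neg h3]
  · filter_upwards [pull (LampTree.ae_tendsto_length hstep), hwalk] with ω h1 h2
    simp_rw [h2]
    exact h1
  · intro X η hX hη a
    -- `X` and `η` are arbitrary versions of the limits, not assumed measurable; almost surely they
    -- agree with events of the step sequence, which is all that `nu1` and `nu2` see.
    have hends : ∀ᵐ ω ∂P, (X ω).1 0 = a ↔ LampTree.EndsIn a (LampTree.stepSeq inc ω) := by
      filter_upwards [hX, hwalk] with ω h1 h2
      simp_rw [h2] at h1
      exact LampTree.endsIn_of_tendsto h1 a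
    have hlamps : ∀ᵐ ω ∂P, ∀ w, η ω w ≠ 0 ↔ LampTree.LampOn w (LampTree.stepSeq inc ω) := by
      filter_upwards [hη, hwalk, htrans] with ω h1 h2 h3 w
      have h4 := h1 w
      simp_rw [h2] at h4
      exact (h3.lampOn_iff_of_tendsto h4).symm
    have h1 : LampTree.nu1 P X η a = (LampTree.seqLaw μ).real (LampTree.onInside a) := by
      rw [← hmap, map_measureReal_apply hS (LampTree.measurableSet_onInside a)]
      refine measureReal_congr ?_
      filter_upwards [hends, hlamps] with ω h1 h2
      refine propext (and_congr (not_congr h1) ?_)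
      push Not
      exact exists_congr fun w => and_congr_right fun _ => h2 w
    have h2 : LampTree.nu2 P X η a = (LampTree.seqLaw μ).real (LampTree.offOutside a) := by
      rw [← hmap, map_measureReal_apply hS (LampTree.measurableSet_offOutside a)]
      refine measureReal_congr ?_
      filter_upwards [hends, hlamps] with ω h1 h2
      refine propext (and_congr h1 (forall₂_congr fun w _ => ?_))
      rw [← h2 w, not_not]
    rw [h1, h2]
    exact LampTree.speed_eq hstep a
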